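/- Three lines in the Euclidean plane form a triangle if any two of them intersect and the three have no common point. For a set $\mathcal L$ of $n$ distinct lines in the plane (parallel and concurrent lines are allowed), consider all triangles formed by triples of lines of $\mathcal L$, and let $T(\mathcal L)$ be the number of those whose area is the maximum among all triangles formed by lines of $\mathcal L$ (with $T(\mathcal L)=0$ if no triangle is formed). Let $M(n)$ be the largest value of $T(\mathcal L)$ over all sets $\mathcal L$ of $n$ distinct lines. Then there is an absolute constant $C$ such that $$\frac{7}{5}n - C < M(n)\quad\text{for all } n\ge 0,\qquad\text{and}\qquad M(n) < \frac{2}{3}n(n-2)\quad\text{for all } n\ge 3.$$ -/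

import Mathlib

open MeasureTheory

/-- The Euclidean plane. -/
abbrev Plane : Type := EuclideanSpace ℝ (Fin 2)

/-- A line of the plane: an affine subspace of dimension one. (The empty affine subspace has a
direction of dimension zero, so a line is automatically nonempty.) -/
def IsLine (l : AffineSubspace ℝ Plane) : Prop :=
  Module.finrank ℝ l.direction = 1

theorem isLine_mk' (p : Plane) {v : Plane} (hv : v ≠ 0) :
    IsLine (AffineSubspace.mk' p (Submodule.span ℝ {v})) := by
  unfold IsLine
  rw [AffineSubspace.direction_mk']
  exact finrank_span_singleton hv

/-- An arrangement of `n` lines: a set of `n` distinct lines. Parallel lines and concurrent lines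
are allowed. -/
def IsArrangement (n : ℕ) (L : Finset (AffineSubspace ℝ Plane)) : Prop :=
  L.card = n ∧ ∀ l ∈ L, IsLine l

/-- The vertices determined by a set of lines: the points lying on two different lines of it. -/
def lineVertices (t : Finset (AffineSubspace ℝ Plane)) : Set Plane :=
  {p | ∃ a ∈ t, ∃ b ∈ t, a ≠ b ∧ p ∈ a ∧ p ∈ b}

/-- Three lines form a triangle if any two of them meet but the three have no common point. -/
def FormsTriangle (t : Finset (AffineSubspace ℝ Plane)) : Prop :=
  t.card = 3 ∧ (∀ a ∈ t, ∀ b ∈ t, a ≠ b → ∃ p : Plane, p ∈ a ∧ p ∈ b) ∧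
    ¬ ∃ p : Plane, ∀ a ∈ t, p ∈ a

/-- The area of the triangle formed by three lines: the Lebesgue measure of the convex hull of
its vertices. -/
noncomputable def triangleArea (t : Finset (AffineSubspace ℝ Plane)) : ENNReal :=
  volume (convexHull ℝ (lineVertices t))

open Classical in
/-- The triangles determined by `L`, each given by the three lines of `L` supporting its sides. -/
noncomputable def triangles (L : Finset (AffineSubspace ℝ Plane)) :
    Finset (Finset (AffineSubspace ℝ Plane)) :=
  L.powerset.filter FormsTriangle

open Classical in
/-- The triangles of maximum area among all triangles determined by `L`. -/
noncomputable def maxAreaTriangles (L : Finset (AffineSubspace ℝ Plane)) :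
    Finset (Finset (AffineSubspace ℝ Plane)) :=
  (triangles L).filter fun t => ∀ s ∈ triangles L, triangleArea s ≤ triangleArea t

/-- The numbers of maximum-area triangles occurring in arrangements of `n` lines. -/
def maxAreaCounts (n : ℕ) : Set ℕ :=
  {k | ∃ L : Finset (AffineSubspace ℝ Plane), IsArrangement n L ∧ (maxAreaTriangles L).card = k}

/-- `M(n)`: the largest possible number of maximum-area triangles determined by `n` lines. -/
noncomputable def maxAreaNumber (n : ℕ) : ℕ := sSup (maxAreaCounts n)

theorem maxAreaCounts_bddAbove (n : ℕ) : BddAbove (maxAreaCounts n) := by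
  classical
  refine ⟨2 ^ n, ?_⟩
  rintro k ⟨L, ⟨hL, -⟩, rfl⟩
  rw [← hL, ← Finset.card_powerset]
  exact Finset.card_le_card ((Finset.filter_subset _ _).trans (Finset.filter_subset _ _))

theorem maxAreaCounts_nonempty (n : ℕ) : (maxAreaCounts n).Nonempty := by
  classical
  let v : Plane := EuclideanSpace.single 1 1
  let f : ℕ → AffineSubspace ℝ Plane := fun i =>
    AffineSubspace.mk' (EuclideanSpace.single 0 (i : ℝ)) (Submodule.span ℝ {v})
  have hv : v ≠ 0 := by
    intro h
    have := congrArg (fun x : Plane => x 1) h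
    simp [v] at this
  have hf : Function.Injective f := by
    intro i j hij
    have h1 : (EuclideanSpace.single 0 (i : ℝ) : Plane) ∈ f j := by
      rw [← hij]; exact AffineSubspace.self_mem_mk' _ _
    rw [AffineSubspace.mem_mk', Submodule.mem_span_singleton] at h1
    obtain ⟨c, hc⟩ := h1
    have := congrArg (fun x : Plane => x 0) hc
    simp [v] at this
    have h2 : (i : ℝ) = j := by linarith
    exact_mod_cast h2
  refine ⟨_, (Finset.range n).image f, ⟨?_, ?_⟩, rfl⟩
  · rw [Finset.card_image_of_injective _ hf, Finset.card_range]
  · intro l hl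
    obtain ⟨i, -, rfl⟩ := Finset.mem_image.1 hl
    exact isLine_mk' _ hv

/-- The supremum defining `M(n)` is an attained maximum. -/
theorem isGreatest_maxAreaNumber (n : ℕ) : IsGreatest (maxAreaCounts n) (maxAreaNumber n) :=
  ⟨Nat.sSup_mem (maxAreaCounts_nonempty n) (maxAreaCounts_bddAbove n),
    fun _ hk => le_csSup (maxAreaCounts_bddAbove n) hk⟩

/-! Upper bound. Fix a line `l` of the arrangement. A line crossing `l` is given by the position `x`
of the crossing and the cotangent `s` of the angle, and `l` and two such lines form a triangle of
area proportional to `(x - x')² / |s - s'|` (`triangleArea_transversal`). If `A` is the maximum of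
this quotient and `u = A s`, then `(x - x')² ≤ |u - u'|` for points `(x, u)` with different `u`, and
the maximal triangles on `l` are the pairs with equality and `x ≠ x'`.

Split these pairs by the sign of their slope. Within a class, chaining two pairs makes `(x - x')²`
exceed `|u - u'|`, since `(p + q)² > p² + q²` for `p, q > 0`; and pairs do not cross in the order by
`u` (`not_risingPair_cross`). Such a graph has fewer edges than vertices (`card_noncrossing_edges`).
With at most `n - 1` transversals, `l` carries at most `2 (n - 2)` maximal triangles, and summing
over the three sides gives `2 n (n - 2) / 3`. The bound is strict on a line with a parallel in the
arrangement. If no lines are parallel, it is strict because equality in both classes would put the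
point of largest `u` both to the right and to the left of the point of smallest `u`.

Lower bound. The five lines of a regular pentagon form five triangles of maximum area. Apply an
affinity taking two of them to the coordinate axes. The maps `(x, y) ↦ (t x, y / t)` preserve area
and both axes, and act on lines `x + u y = w` by `(u, w) ↦ (t² u, t w)`. Keep the axes and add the
images of the other three lines for `t = 1000 ^ m`. Each `m` costs three lines and brings five new
triangles of normalized area one; the scales are so far apart that no larger triangle arises
(`chain_coordDet_sq_le`). Hence `M(n) ≥ 5 ⌊(n - 2) / 3⌋`, more than is needed. -/

/-! ### Lines in coordinates and the area of a triangle as a determinant quotient -/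

/-- The set of points `p` with `a * p 0 + b * p 1 = c`, a line unless `a = b = 0`. -/
def coordLine (a b c : ℝ) : AffineSubspace ℝ Plane where
  carrier := {p | a * p 0 + b * p 1 = c}
  smul_vsub_vadd_mem' := by
    intro k p q r hp hq hr
    simp only [Set.mem_ofPred_eq] at *
    simp only [vsub_eq_sub, vadd_eq_add, PiLp.add_apply, PiLp.smul_apply, PiLp.sub_apply,
      smul_eq_mul]
    linear_combination k * hp - k * hq + hr

@[simp] theorem mem_coordLine {a b c : ℝ} {p : Plane} :
    p ∈ coordLine a b c ↔ a * p 0 + b * p 1 = c := Iff.rfl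

theorem eq_coordLine_of_direction_eq_span {l : AffineSubspace ℝ Plane} {p v : Plane} (hp : p ∈ l)
    (hv : v ≠ 0) (hl : l.direction = Submodule.span ℝ {v}) :
    l = coordLine (-v 1) (v 0) (-v 1 * p 0 + v 0 * p 1) := by
  ext q
  rw [← AffineSubspace.vsub_right_mem_direction_iff_mem hp, hl, Submodule.mem_span_singleton,
    mem_coordLine]
  constructor
  · rintro ⟨k, hk⟩
    have h0 : k * v 0 = q 0 - p 0 := by simpa using congrArg (fun x : Plane => x 0) hk
    have h1 : k * v 1 = q 1 - p 1 := by simpa using congrArg (fun x : Plane => x 1) hk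
    linear_combination v 1 * h0 - v 0 * h1
  · intro h
    have hN : v 0 * v 0 + v 1 * v 1 ≠ 0 := by
      intro h0
      apply hv
      ext i
      fin_cases i
      · simp only [Fin.zero_eta, PiLp.zero_apply]; nlinarith [sq_nonneg (v 0), sq_nonneg (v 1)]
      · simp only [Fin.mk_one, PiLp.zero_apply]; nlinarith [sq_nonneg (v 0), sq_nonneg (v 1)]
    refine ⟨((q 0 - p 0) * v 0 + (q 1 - p 1) * v 1) / (v 0 * v 0 + v 1 * v 1), ?_⟩
    ext i
    fin_cases i
    · simp only [Fin.zero_eta, PiLp.smul_apply, smul_eq_mul, vsub_eq_sub, PiLp.sub_apply]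
      rw [div_mul_eq_mul_div, div_eq_iff hN]
      linear_combination v 1 * h
    · simp only [Fin.mk_one, PiLp.smul_apply, smul_eq_mul, vsub_eq_sub, PiLp.sub_apply]
      rw [div_mul_eq_mul_div, div_eq_iff hN]
      linear_combination (-v 0) * h

/-- Every line has an equation with a unit normal vector. -/
theorem IsLine.exists_eq_coordLine {l : AffineSubspace ℝ Plane} (hl : IsLine l) :
    ∃ a b c : ℝ, a ^ 2 + b ^ 2 = 1 ∧ l = coordLine a b c := by
  have hne : (l : Set Plane).Nonempty := by
    rw [Set.nonempty_iff_ne_empty, Ne, AffineSubspace.coe_eq_bot_iff]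
    rintro rfl
    rw [IsLine, AffineSubspace.direction_bot, finrank_bot] at hl
    exact zero_ne_one hl
  obtain ⟨p, hp⟩ := hne
  obtain ⟨⟨v, hvl⟩, hv0, hv⟩ := finrank_eq_one_iff'.1 hl
  have hv0' : v ≠ 0 := fun h => hv0 (Subtype.ext h)
  have hspan : l.direction = Submodule.span ℝ {v} := by
    ext w
    rw [Submodule.mem_span_singleton]
    constructor
    · intro hw
      obtain ⟨c, hc⟩ := hv ⟨w, hw⟩
      exact ⟨c, congrArg Subtype.val hc⟩
    · rintro ⟨c, rfl⟩
      exact l.direction.smul_mem c hvl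
  have hN : 0 < v 0 ^ 2 + v 1 ^ 2 := by
    by_contra h0
    apply hv0'
    ext i
    fin_cases i
    · simp only [Fin.zero_eta, PiLp.zero_apply]; nlinarith [sq_nonneg (v 0), sq_nonneg (v 1)]
    · simp only [Fin.mk_one, PiLp.zero_apply]; nlinarith [sq_nonneg (v 0), sq_nonneg (v 1)]
  set N := Real.sqrt (v 0 ^ 2 + v 1 ^ 2) with hNdef
  have hNpos : 0 < N := Real.sqrt_pos.2 hN
  have hNsq : N ^ 2 = v 0 ^ 2 + v 1 ^ 2 := Real.sq_sqrt hN.le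
  have hsmul : (N⁻¹ • v : Plane) ≠ 0 := smul_ne_zero (inv_ne_zero hNpos.ne') hv0'
  have hspan' : l.direction = Submodule.span ℝ {N⁻¹ • v} := by
    rw [hspan, Submodule.span_singleton_smul_eq (IsUnit.mk0 _ (inv_ne_zero hNpos.ne'))]
  refine ⟨_, _, _, ?_, eq_coordLine_of_direction_eq_span hp hsmul hspan'⟩
  simp only [PiLp.smul_apply, smul_eq_mul]
  field_simp
  linarith

theorem isLine_coordLine {a b c : ℝ} (h : a ≠ 0 ∨ b ≠ 0) : IsLine (coordLine a b c) := by
  have hN : a * a + b * b ≠ 0 := by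
    intro h0
    have ha : a = 0 := by nlinarith [sq_nonneg a, sq_nonneg b]
    have hb : b = 0 := by nlinarith [sq_nonneg a, sq_nonneg b]
    tauto
  have hv : (!₂[b, -a] : Plane) ≠ 0 := by
    intro h0
    have h1 : b = 0 := by simpa using congrArg (fun x : Plane => x 0) h0
    have h2 : a = 0 := by simpa using congrArg (fun x : Plane => x 1) h0
    tauto
  have key := isLine_mk' (!₂[a * c / (a * a + b * b), b * c / (a * a + b * b)] : Plane) hv
  rw [eq_coordLine_of_direction_eq_span (AffineSubspace.self_mem_mk' _ _) hv
    (AffineSubspace.direction_mk' _ _)] at key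
  convert key using 2
  · simp
  · simp
  · simp only [Matrix.cons_val_zero, Matrix.cons_val_one]
    rw [mul_div_assoc', mul_div_assoc', ← add_div, eq_div_iff hN]
    ring

theorem coordLine_smul {k a b c : ℝ} (hk : k ≠ 0) :
    coordLine (k * a) (k * b) (k * c) = coordLine a b c := by
  ext p
  simp only [mem_coordLine]
  constructor
  · intro h
    exact mul_left_cancel₀ hk (by linear_combination h)
  · intro h
    linear_combination k * h

/-- Two lines with proportional normal vectors and a common point are equal. -/
theorem coordLine_eq_of_mem {a b c a' b' c' : ℝ} {p : Plane} (h : a ≠ 0 ∨ b ≠ 0)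
    (h' : a' ≠ 0 ∨ b' ≠ 0) (hD : a * b' - a' * b = 0) (hp : p ∈ coordLine a b c)
    (hp' : p ∈ coordLine a' b' c') : coordLine a b c = coordLine a' b' c' := by
  rw [mem_coordLine] at hp hp'
  subst hp hp'
  rcases h with h | h
  · have ha' : a' ≠ 0 := by
      rintro rfl
      have : b' = 0 := by
        apply mul_left_cancel₀ h
        linarith
      tauto
    rw [← coordLine_smul ha', ← coordLine_smul (a := a') h]
    congr 1
    · ring
    · linarith
    · linear_combination (-p 1) * hD
  · have hb' : b' ≠ 0 := by
      rintro rfl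
      have : a' = 0 := by
        apply mul_right_cancel₀ h
        linarith
      tauto
    rw [← coordLine_smul hb', ← coordLine_smul (a := a') h]
    congr 1
    · linarith
    · ring
    · linear_combination (p 0) * hD

/-- Cramer's rule for the intersection of two lines. -/
noncomputable def coordMeet (a b c a' b' c' : ℝ) : Plane :=
  !₂[(c * b' - c' * b) / (a * b' - a' * b), (a * c' - a' * c) / (a * b' - a' * b)]

theorem mem_coordLine_and_iff {a b c a' b' c' : ℝ} (hD : a * b' - a' * b ≠ 0) (p : Plane) :
    (p ∈ coordLine a b c ∧ p ∈ coordLine a' b' c') ↔ p = coordMeet a b c a' b' c' := by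
  simp only [mem_coordLine]
  constructor
  · rintro ⟨h, h'⟩
    ext i
    fin_cases i
    · simp [coordMeet]
      rw [eq_div_iff hD]
      linear_combination b' * h - b * h'
    · simp [coordMeet]
      rw [eq_div_iff hD]
      linear_combination a * h' - a' * h
  · rintro rfl
    simp only [coordMeet, PiLp.toLp_apply, Matrix.cons_val_zero, Matrix.cons_val_one]
    constructor <;>
    · rw [mul_div_assoc', mul_div_assoc', ← add_div, div_eq_iff hD]
      ring

/-- The determinant of the equations of three lines. -/
def coordDet (a₁ b₁ c₁ a₂ b₂ c₂ a₃ b₃ c₃ : ℝ) : ℝ :=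
  c₁ * (a₂ * b₃ - a₃ * b₂) - c₂ * (a₁ * b₃ - a₃ * b₁) + c₃ * (a₁ * b₂ - a₂ * b₁)

/-- The area of the standard triangle. -/
noncomputable def unitTriangleArea : ENNReal :=
  volume (convexHull ℝ ({0, !₂[1, 0], !₂[0, 1]} : Set Plane))

/-- The triangle is an affine image of the standard one, and Lebesgue measure scales by the
determinant. The area of the standard triangle is never evaluated: areas are only compared, so it
suffices that it is neither zero nor infinite. -/
theorem volume_convexHull_triple (p q r : Plane) :
    volume (convexHull ℝ ({p, q, r} : Set Plane)) =
      ENNReal.ofReal |(q 0 - p 0) * (r 1 - p 1) - (q 1 - p 1) * (r 0 - p 0)| *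
        unitTriangleArea := by
  let M : Matrix (Fin 2) (Fin 2) ℝ := !![q 0 - p 0, r 0 - p 0; q 1 - p 1, r 1 - p 1]
  let f : Plane →ₗ[ℝ] Plane := Matrix.toLin (EuclideanSpace.basisFun (Fin 2) ℝ).toBasis
    (EuclideanSpace.basisFun (Fin 2) ℝ).toBasis M
  have hdet : LinearMap.det f = (q 0 - p 0) * (r 1 - p 1) - (q 1 - p 1) * (r 0 - p 0) := by
    rw [LinearMap.det_toLin, Matrix.det_fin_two_of]
    ring
  have hf : ∀ x : Plane, f x = !₂[(q 0 - p 0) * x 0 + (r 0 - p 0) * x 1,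
      (q 1 - p 1) * x 0 + (r 1 - p 1) * x 1] := by
    intro x
    ext i
    fin_cases i <;>
      simp [f, M, Matrix.toLin_apply, Matrix.mulVec, dotProduct, Fin.sum_univ_two]
  have himg : ({p, q, r} : Set Plane) =
      (fun x => p + x) '' (f '' {0, !₂[1, 0], !₂[0, 1]}) := by
    simp only [Set.image_insert_eq, Set.image_singleton, hf]
    have h1 : q = p + !₂[q 0 - p 0, q 1 - p 1] := by
      ext i; fin_cases i <;> simp
    have h2 : r = p + !₂[r 0 - p 0, r 1 - p 1] := by
      ext i; fin_cases i <;> simp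
    have h0 : p + !₂[(0 : ℝ), 0] = p := by
      ext i; fin_cases i <;> simp
    simp [← h1, ← h2, h0]
  have htr : convexHull ℝ ((fun x => p + x) '' (f '' {0, !₂[1, 0], !₂[0, 1]})) =
      (fun x => p + x) '' (f '' convexHull ℝ {0, !₂[1, 0], !₂[0, 1]}) := by
    rw [LinearMap.image_convexHull]
    exact ((AffineEquiv.constVAdd ℝ Plane p).toAffineMap.image_convexHull _).symm
  rw [himg, htr, Set.image_add_left, measure_preimage_add, Measure.addHaar_image_linearMap, hdet,
    unitTriangleArea]

theorem unitTriangleArea_ne_top : unitTriangleArea ≠ ⊤ := by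
  have : ({0, !₂[1, 0], !₂[0, 1]} : Set Plane).Finite := by simp
  exact (this.isCompact_convexHull (𝕜 := ℝ)).measure_lt_top.ne

theorem unitTriangleArea_ne_zero : unitTriangleArea ≠ 0 := by
  have hspan : affineSpan ℝ ({0, !₂[1, 0], !₂[0, 1]} : Set Plane) = ⊤ := by
    rw [eq_top_iff]
    intro x _
    have h0 : (0 : Plane) ∈ affineSpan ℝ ({0, !₂[1, 0], !₂[0, 1]} : Set Plane) :=
      subset_affineSpan _ _ (by simp)
    have h1 : (!₂[1, 0] : Plane) ∈ affineSpan ℝ ({0, !₂[1, 0], !₂[0, 1]} : Set Plane) :=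
      subset_affineSpan _ _ (by simp)
    have h2 : (!₂[0, 1] : Plane) ∈ affineSpan ℝ ({0, !₂[1, 0], !₂[0, 1]} : Set Plane) :=
      subset_affineSpan _ _ (by simp)
    have h3 := AffineSubspace.smul_vsub_vadd_mem _ (x 1) h2 h0
      (AffineSubspace.smul_vsub_vadd_mem _ (x 0) h1 h0 h0)
    convert h3 using 1
    ext i
    fin_cases i <;> simp
  have hint := interior_convexHull_nonempty_iff_affineSpan_eq_top.2 hspan
  intro h
  have := (isOpen_interior.measure_pos volume hint)
  exact (this.trans_le (measure_mono interior_subset)).ne' h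

open Classical in
theorem triangleArea_coordLine {a₁ b₁ c₁ a₂ b₂ c₂ a₃ b₃ c₃ : ℝ} (h12 : a₁ * b₂ - a₂ * b₁ ≠ 0)
    (h13 : a₁ * b₃ - a₃ * b₁ ≠ 0) (h23 : a₂ * b₃ - a₃ * b₂ ≠ 0)
    (hne12 : coordLine a₁ b₁ c₁ ≠ coordLine a₂ b₂ c₂)
    (hne13 : coordLine a₁ b₁ c₁ ≠ coordLine a₃ b₃ c₃)
    (hne23 : coordLine a₂ b₂ c₂ ≠ coordLine a₃ b₃ c₃) :
    triangleArea {coordLine a₁ b₁ c₁, coordLine a₂ b₂ c₂, coordLine a₃ b₃ c₃} =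
      ENNReal.ofReal (coordDet a₁ b₁ c₁ a₂ b₂ c₂ a₃ b₃ c₃ ^ 2 /
        (|a₁ * b₂ - a₂ * b₁| * |a₁ * b₃ - a₃ * b₁| * |a₂ * b₃ - a₃ * b₂|)) *
        unitTriangleArea := by
  have hv : lineVertices {coordLine a₁ b₁ c₁, coordLine a₂ b₂ c₂, coordLine a₃ b₃ c₃} =
      {coordMeet a₁ b₁ c₁ a₂ b₂ c₂, coordMeet a₁ b₁ c₁ a₃ b₃ c₃, coordMeet a₂ b₂ c₂ a₃ b₃ c₃} := by
    ext p
    simp only [Set.mem_insert_iff, Set.mem_singleton_iff]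
    rw [← mem_coordLine_and_iff h12, ← mem_coordLine_and_iff h13, ← mem_coordLine_and_iff h23]
    simp only [lineVertices, Set.mem_ofPred_eq, Finset.mem_insert, Finset.mem_singleton]
    constructor
    · rintro ⟨x, rfl | rfl | rfl, y, rfl | rfl | rfl, hxy, hx, hy⟩ <;> tauto
    · rintro (⟨h, h'⟩ | ⟨h, h'⟩ | ⟨h, h'⟩)
      · exact ⟨_, .inl rfl, _, .inr (.inl rfl), hne12, h, h'⟩
      · exact ⟨_, .inl rfl, _, .inr (.inr rfl), hne13, h, h'⟩
      · exact ⟨_, .inr (.inl rfl), _, .inr (.inr rfl), hne23, h, h'⟩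
  rw [triangleArea, hv, volume_convexHull_triple, ← abs_mul, ← abs_mul, ← abs_of_nonneg
    (sq_nonneg (coordDet a₁ b₁ c₁ a₂ b₂ c₂ a₃ b₃ c₃)), ← abs_div]
  congr 3
  simp only [coordMeet, PiLp.toLp_apply, Matrix.cons_val_zero, Matrix.cons_val_one]
  rw [div_sub_div _ _ h13 h12, div_sub_div _ _ h13 h12, div_sub_div _ _ h23 h12,
    div_sub_div _ _ h23 h12, div_mul_div_comm, div_mul_div_comm,
    mul_comm ((a₁ * b₃ - a₃ * b₁) * (a₁ * b₂ - a₂ * b₁)), ← sub_div, div_eq_div_iff]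
  · unfold coordDet
    ring
  · positivity
  · positivity

open Classical in
theorem formsTriangle_coordLine_iff {a₁ b₁ c₁ a₂ b₂ c₂ a₃ b₃ c₃ : ℝ}
    (h1 : a₁ ≠ 0 ∨ b₁ ≠ 0) (h2 : a₂ ≠ 0 ∨ b₂ ≠ 0) (h3 : a₃ ≠ 0 ∨ b₃ ≠ 0)
    (hne12 : coordLine a₁ b₁ c₁ ≠ coordLine a₂ b₂ c₂)
    (hne13 : coordLine a₁ b₁ c₁ ≠ coordLine a₃ b₃ c₃)
    (hne23 : coordLine a₂ b₂ c₂ ≠ coordLine a₃ b₃ c₃) :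
    FormsTriangle {coordLine a₁ b₁ c₁, coordLine a₂ b₂ c₂, coordLine a₃ b₃ c₃} ↔
      a₁ * b₂ - a₂ * b₁ ≠ 0 ∧ a₁ * b₃ - a₃ * b₁ ≠ 0 ∧ a₂ * b₃ - a₃ * b₂ ≠ 0 ∧
        coordDet a₁ b₁ c₁ a₂ b₂ c₂ a₃ b₃ c₃ ≠ 0 := by
  have hmeet : ∀ p, p ∈ coordLine a₁ b₁ c₁ ∧ p ∈ coordLine a₂ b₂ c₂ ∧ p ∈ coordLine a₃ b₃ c₃ →
      coordDet a₁ b₁ c₁ a₂ b₂ c₂ a₃ b₃ c₃ = 0 := by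
    rintro p ⟨hp1, hp2, hp3⟩
    rw [mem_coordLine] at hp1 hp2 hp3
    subst hp1 hp2 hp3
    unfold coordDet
    ring
  constructor
  · rintro ⟨-, hm, hc⟩
    have hD : a₁ * b₂ - a₂ * b₁ ≠ 0 := by
      obtain ⟨p, hp, hp'⟩ := hm _ (by simp) _ (by simp) hne12
      exact fun h => hne12 (coordLine_eq_of_mem h1 h2 h hp hp')
    refine ⟨hD, ?_, ?_, ?_⟩
    · obtain ⟨p, hp, hp'⟩ := hm _ (by simp) _ (by simp) hne13
      exact fun h => hne13 (coordLine_eq_of_mem h1 h3 h hp hp')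
    · obtain ⟨p, hp, hp'⟩ := hm _ (by simp) _ (by simp) hne23
      exact fun h => hne23 (coordLine_eq_of_mem h2 h3 h hp hp')
    · intro h0
      apply hc
      obtain ⟨hp1, hp2⟩ := (mem_coordLine_and_iff (c := c₁) (c' := c₂) hD _).2 rfl
      refine ⟨coordMeet a₁ b₁ c₁ a₂ b₂ c₂, ?_⟩
      simp only [Finset.mem_insert, Finset.mem_singleton]
      rintro a (rfl | rfl | rfl)
      · exact hp1
      · exact hp2
      · simp only [coordMeet, mem_coordLine, Matrix.cons_val_zero,
          Matrix.cons_val_one]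
        rw [mul_div_assoc', mul_div_assoc', ← add_div, div_eq_iff hD]
        unfold coordDet at h0
        linear_combination (-1 : ℝ) * h0
  · rintro ⟨h12, h13, h23, hd⟩
    refine ⟨Finset.card_eq_three.2 ⟨_, _, _, hne12, hne13, hne23, rfl⟩, ?_, ?_⟩
    · have k12 := (mem_coordLine_and_iff (c := c₁) (c' := c₂) h12 _).2 rfl
      have k13 := (mem_coordLine_and_iff (c := c₁) (c' := c₃) h13 _).2 rfl
      have k23 := (mem_coordLine_and_iff (c := c₂) (c' := c₃) h23 _).2 rfl
      simp only [Finset.mem_insert, Finset.mem_singleton]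
      rintro x (rfl | rfl | rfl) y (rfl | rfl | rfl) hxy
      · exact absurd rfl hxy
      · exact ⟨_, k12⟩
      · exact ⟨_, k13⟩
      · exact ⟨_, k12.symm⟩
      · exact absurd rfl hxy
      · exact ⟨_, k23⟩
      · exact ⟨_, k13.symm⟩
      · exact ⟨_, k23.symm⟩
      · exact absurd rfl hxy
    · rintro ⟨p, hp⟩
      exact hd (hmeet p ⟨hp _ (by simp), hp _ (by simp), hp _ (by simp)⟩)

/-! ### Noncrossing graphs and rising pairs -/

open Classical in
/-- A graph on a finite linear order without crossing edges, none of whose edges is bypassed by a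
monotone path, has fewer edges than vertices; in case of equality the first and the last vertex are
joined by a monotone path. Here `Q` is a transitive relation containing the edge relation `E`. -/
theorem card_noncrossing_edges {α : Type*} [LinearOrder α] {E Q : α → α → Prop}
    (hlt : ∀ i k, E i k → i < k) (hEQ : ∀ i k, E i k → Q i k)
    (htrans : ∀ i j k, Q i j → Q j k → Q i k ∧ ¬ E i k)
    (hcross : ∀ i j k l, i < j → j < k → k < l → E i k → E j l → False) (S : Finset α) :
    ∀ a ∈ S, ∀ b ∈ S, (∀ x ∈ S, a ≤ x ∧ x ≤ b) →
      ((S ×ˢ S).filter fun p => E p.1 p.2).card + 1 ≤ S.card ∧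
      (((S ×ˢ S).filter fun p => E p.1 p.2).card + 1 = S.card → a = b ∨ Q a b) := by
  induction S using Finset.strongInduction with
  | H S ih =>
  intro a ha b hb hab
  by_cases hne : a = b
  · subst hne
    have h0 : ((S ×ˢ S).filter fun p => E p.1 p.2) = ∅ := by
      rw [Finset.filter_eq_empty_iff]
      rintro ⟨i, k⟩ hik hE
      rw [Finset.mem_product] at hik
      exact absurd (hlt _ _ hE) (not_lt.2 ((hab k hik.2).2.trans (hab i hik.1).1))
    rw [h0]
    exact ⟨by simpa using ⟨a, ha⟩, fun _ => .inl rfl⟩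
  have hlt_ab : a < b := lt_of_le_of_ne (hab b hb).1 hne
  by_cases hc : (S.filter fun c => a < c ∧ c < b ∧ E a c).Nonempty
  -- Split at the farthest neighbour `c ≠ b` of the first vertex `a`. The two halves share only `c`,
  -- so their edge bounds add up to `S.card - 1`.
  · obtain ⟨c, hcS, hcmax⟩ := Finset.exists_max_image _ id hc
    simp only [Finset.mem_filter, id] at hcS hcmax
    obtain ⟨hcS, hac, hcb, hEac⟩ := hcS
    set S₁ := S.filter fun x => x ≤ c with hS₁
    set S₂ := S.filter fun x => c ≤ x with hS₂
    have hss₁ : S₁ ⊂ S := by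
      rw [Finset.ssubset_iff_of_subset (Finset.filter_subset _ _)]
      exact ⟨b, hb, by simp [hcb]⟩
    have hss₂ : S₂ ⊂ S := by
      rw [Finset.ssubset_iff_of_subset (Finset.filter_subset _ _)]
      exact ⟨a, ha, by simp [hac]⟩
    have hcard : S₁.card + S₂.card = S.card + 1 := by
      rw [← Finset.card_union_add_card_inter]
      congr 1
      · congr 1
        ext x
        simp only [hS₁, hS₂, Finset.mem_union, Finset.mem_filter]
        have := le_total x c
        tauto
      · rw [Finset.card_eq_one]
        refine ⟨c, ?_⟩
        ext x
        simp only [hS₁, hS₂, Finset.mem_inter, Finset.mem_filter, Finset.mem_singleton]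
        constructor
        · rintro ⟨⟨-, h1⟩, -, h2⟩
          exact le_antisymm h1 h2
        · rintro rfl
          simp [hcS]
    obtain ⟨h1, h1'⟩ := ih S₁ hss₁ a (by simp [hS₁, ha, hac.le]) c (by simp [hS₁, hcS])
      (fun x hx => ⟨(hab x (Finset.mem_filter.1 hx).1).1, (Finset.mem_filter.1 hx).2⟩)
    obtain ⟨h2, h2'⟩ := ih S₂ hss₂ c (by simp [hS₂, hcS]) b (by simp [hS₂, hb, hcb.le])
      (fun x hx => ⟨(Finset.mem_filter.1 hx).2, (hab x (Finset.mem_filter.1 hx).1).2⟩)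
    have hQac : S₁.card = ((S₁ ×ˢ S₁).filter fun p => E p.1 p.2).card + 1 → Q a c :=
      fun h => (h1' h.symm).resolve_left hac.ne
    have hQcb : S₂.card = ((S₂ ×ˢ S₂).filter fun p => E p.1 p.2).card + 1 → Q c b :=
      fun h => (h2' h.symm).resolve_left hcb.ne
    have hsub : ∀ p ∈ (S ×ˢ S).filter (fun p => E p.1 p.2), p ≠ (a, b) →
        p ∈ ((S₁ ×ˢ S₁).filter fun p => E p.1 p.2) ∪ ((S₂ ×ˢ S₂).filter fun p => E p.1 p.2) := by
      rintro ⟨i, k⟩ hik hne'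
      simp only [Finset.mem_filter, Finset.mem_product] at hik
      obtain ⟨⟨hi, hk⟩, hE⟩ := hik
      have hik := hlt _ _ hE
      simp only [Finset.mem_union, Finset.mem_filter, Finset.mem_product, hS₁, hS₂]
      rcases le_or_gt k c with hkc | hck
      · exact .inl ⟨⟨⟨hi, hik.le.trans hkc⟩, hk, hkc⟩, hE⟩
      rcases le_or_gt c i with hci | hic
      · exact .inr ⟨⟨⟨hi, hci⟩, hk, hci.trans hik.le⟩, hE⟩
      exfalso
      -- An edge straddling `c` either starts at `a`, against the choice of `c`, or crosses the edge
      -- from `a` to `c`.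
      rcases (hab i hi).1.eq_or_lt with rfl | hai
      · have hkb : k ≠ b := fun h => hne' (by rw [h])
        exact absurd (hcmax k ⟨hk, hik, lt_of_le_of_ne (hab k hk).2 hkb, hE⟩) (not_le.2 hck)
      · exact hcross a i c k hai hic hck hEac hE
    by_cases hEab : E a b
    · have hle : ((S ×ˢ S).filter fun p => E p.1 p.2).card ≤
          ((S₁ ×ˢ S₁).filter fun p => E p.1 p.2).card +
            ((S₂ ×ˢ S₂).filter fun p => E p.1 p.2).card + 1 := by
        refine (Finset.card_le_card (t := insert (a, b) (_ ∪ _)) fun p hp => ?_).trans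
          ((Finset.card_insert_le _ _).trans
            (Nat.add_le_add_right (Finset.card_union_le _ _) 1))
        by_cases hp' : p = (a, b)
        · simp [hp']
        · exact Finset.mem_insert_of_mem (hsub p hp hp')
      refine ⟨?_, fun _ => .inr (hEQ _ _ hEab)⟩
      by_contra hcon
      exact (htrans a c b (hQac (by omega)) (hQcb (by omega))).2 hEab
    · have hle : ((S ×ˢ S).filter fun p => E p.1 p.2).card ≤
          ((S₁ ×ˢ S₁).filter fun p => E p.1 p.2).card +
            ((S₂ ×ˢ S₂).filter fun p => E p.1 p.2).card := by
        refine (Finset.card_le_card fun p hp => hsub p hp ?_).trans (Finset.card_union_le _ _)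
        rintro rfl
        exact hEab (Finset.mem_filter.1 hp).2
      exact ⟨by omega, fun heq => .inr (htrans a c b (hQac (by omega)) (hQcb (by omega))).1⟩
  -- Now `a` has no neighbour other than possibly `b`, so deleting `a` loses at most one edge.
  · have hbS : b ∈ S.erase a := Finset.mem_erase.2 ⟨Ne.symm hne, hb⟩
    have hcard : (S.erase a).card + 1 = S.card := Finset.card_erase_add_one ha
    obtain ⟨h1, -⟩ := ih (S.erase a) (Finset.erase_ssubset ha) _
      (Finset.min'_mem _ ⟨b, hbS⟩) b hbS
      (fun x hx => ⟨Finset.min'_le _ _ hx, (hab x (Finset.mem_of_mem_erase hx)).2⟩)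
    have hsub : ∀ p ∈ (S ×ˢ S).filter (fun p => E p.1 p.2), p ≠ (a, b) →
        p ∈ ((S.erase a ×ˢ S.erase a).filter fun p => E p.1 p.2) := by
      rintro ⟨i, k⟩ hik hne'
      simp only [Finset.mem_filter, Finset.mem_product] at hik
      obtain ⟨⟨hi, hk⟩, hE⟩ := hik
      have hik := hlt _ _ hE
      simp only [Finset.mem_filter, Finset.mem_product, Finset.mem_erase]
      refine ⟨⟨⟨?_, hi⟩, ((hab i hi).1.trans_lt hik).ne', hk⟩, hE⟩
      rintro rfl
      have hkb : k ≠ b := fun h => hne' (by rw [h])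
      exact hc ⟨k, Finset.mem_filter.2 ⟨hk, hik, lt_of_le_of_ne (hab k hk).2 hkb, hE⟩⟩
    by_cases hEab : E a b
    · have hle : ((S ×ˢ S).filter fun p => E p.1 p.2).card ≤
          ((S.erase a ×ˢ S.erase a).filter fun p => E p.1 p.2).card + 1 := by
        refine (Finset.card_le_card (t := insert (a, b) _) fun p hp => ?_).trans
          (Finset.card_insert_le _ _)
        by_cases hp' : p = (a, b)
        · simp [hp']
        · exact Finset.mem_insert_of_mem (hsub p hp hp')
      exact ⟨by omega, fun _ => .inr (hEQ _ _ hEab)⟩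
    · have hle : ((S ×ˢ S).filter fun p => E p.1 p.2).card ≤
          ((S.erase a ×ˢ S.erase a).filter fun p => E p.1 p.2).card := by
        refine Finset.card_le_card fun p hp => hsub p hp ?_
        rintro rfl
        exact hEab (Finset.mem_filter.1 hp).2
      exact ⟨by omega, fun heq => by omega⟩

/-- Pairs of points `(x, u)`, the second one to the upper right of the first, whose height
difference is the square of the horizontal distance. -/
def RisingPair {ι : Type*} (x u : ι → ℝ) (i k : ι) : Prop :=
  x i < x k ∧ u i < u k ∧ (x k - x i) ^ 2 = u k - u i

/-- Let `p, q, r` be the successive differences of `x`. Without ties in `u`, the equalities for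
`ik`, `jl` and the inequalities for the other pairs give `p q ≥ 0`, `q r ≥ 0` and `p r ≤ 0`, while
`p` and `r` must be positive. In a tie the point with larger `x` comes first; moving an end of a
rising pair to its tied neighbour then lengthens the horizontal distance at the same height, against
the inequality. -/
theorem not_risingPair_cross {xi xj xk xl ui uj uk ul : ℝ}
    (hlij : ui < uj ∨ ui = uj ∧ xj < xi) (hljk : uj < uk ∨ uj = uk ∧ xk < xj)
    (hlkl : uk < ul ∨ uk = ul ∧ xl < xk)
    (hik : xi < xk) (hik' : (xk - xi) ^ 2 = uk - ui) (huik : ui < uk)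
    (hjl : xj < xl) (hjl' : (xl - xj) ^ 2 = ul - uj)
    (hij : ui < uj → (xj - xi) ^ 2 ≤ uj - ui) (hjk : uj < uk → (xk - xj) ^ 2 ≤ uk - uj)
    (hkl : uk < ul → (xl - xk) ^ 2 ≤ ul - uk) (hil : (xl - xi) ^ 2 ≤ ul - ui) : False := by
  rcases hlij with h1 | ⟨h1, h1'⟩
  · have hij := hij h1
    rcases hljk with h2 | ⟨h2, h2'⟩
    · have hjk := hjk h2
      rcases hlkl with h3 | ⟨h3, h3'⟩
      · have hkl := hkl h3
        have hab : 0 ≤ (xj - xi) * (xk - xj) := by nlinarith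
        have hbc : 0 ≤ (xk - xj) * (xl - xk) := by nlinarith
        have hac : (xj - xi) * (xl - xk) ≤ 0 := by nlinarith
        have ha : 0 < xj - xi := by
          by_contra hcon
          nlinarith
        have hc : 0 < xl - xk := by
          by_contra hcon
          nlinarith
        nlinarith
      · nlinarith
    · nlinarith
  · have hjk := hjk (h1 ▸ huik)
    nlinarith

open Classical in
theorem card_risingPair_le {ι : Type*} (S : Finset ι) (x u : ι → ℝ) (hS : S.Nonempty)
    (hinj : ∀ i j, x i = x j → u i = u j → i = j)
    (hP : ∀ i ∈ S, ∀ j ∈ S, u i < u j → (x j - x i) ^ 2 ≤ u j - u i) :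
    ((S ×ˢ S).filter fun p => RisingPair x u p.1 p.2).card + 1 ≤ S.card ∧
    (((S ×ˢ S).filter fun p => RisingPair x u p.1 p.2).card + 1 = S.card →
      ∀ a ∈ S, ∀ b ∈ S, (∀ i ∈ S, i ≠ a → u a < u i) → (∀ i ∈ S, i ≠ b → u i < u b) →
        a = b ∨ x a < x b) := by
  let _ : LinearOrder ι := LinearOrder.lift' (fun i => toLex (u i, -x i)) (by
    intro i j h
    have h' := congrArg ofLex h
    simp only [ofLex_toLex, Prod.mk.injEq, neg_inj] at h'
    exact hinj i j h'.2 h'.1)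
  have hlt : ∀ i j : ι, i < j ↔ u i < u j ∨ u i = u j ∧ x j < x i := by
    intro i j
    change toLex (u i, -x i) < toLex (u j, -x j) ↔ _
    rw [Prod.Lex.toLex_lt_toLex]
    simp
  have hle_u : ∀ i j : ι, i ≤ j → u i ≤ u j := by
    intro i j h
    rcases h.eq_or_lt with rfl | h
    · exact le_rfl
    · rcases (hlt i j).1 h with h | h
      · exact h.le
      · exact h.1.le
  obtain ⟨h1, h2⟩ := card_noncrossing_edges
    (E := fun i k => i ∈ S ∧ k ∈ S ∧ RisingPair x u i k)
    (Q := fun i k => x i < x k ∧ u k - u i ≤ (x k - x i) ^ 2)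
    (fun i k h => (hlt i k).2 (.inl h.2.2.2.1))
    (fun i k h => ⟨h.2.2.1, h.2.2.2.2.ge⟩)
    (by
      rintro i j k ⟨h1, h2⟩ ⟨h3, h4⟩
      -- Strict because the product of the two positive horizontal steps is positive.
      have h5 : u k - u i < (x k - x i) ^ 2 := by nlinarith
      exact ⟨⟨h1.trans h3, h5.le⟩, fun h => h5.ne' h.2.2.2.2⟩)
    (by
      rintro i j k l hij hjk hkl ⟨hi, hk, h1, h2, h3⟩ ⟨hj, hl, h4, h5, h6⟩
      exact not_risingPair_cross ((hlt _ _).1 hij) ((hlt _ _).1 hjk) ((hlt _ _).1 hkl) h1 h3 h2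
        h4 h6 (hP i hi j hj) (hP j hj k hk) (hP k hk l hl)
        (hP i hi l hl (h2.trans_le (hle_u _ _ hkl.le))))
    S (S.min' hS) (S.min'_mem hS) (S.max' hS) (S.max'_mem hS)
    (fun y hy => ⟨S.min'_le y hy, S.le_max' y hy⟩)
  have hfil (inst : DecidablePred fun p : ι × ι => p.1 ∈ S ∧ p.2 ∈ S ∧ RisingPair x u p.1 p.2) :
      @Finset.filter _ (fun p => p.1 ∈ S ∧ p.2 ∈ S ∧ RisingPair x u p.1 p.2) inst (S ×ˢ S) =
      (S ×ˢ S).filter fun p => RisingPair x u p.1 p.2 := by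
    refine Finset.filter_congr fun p hp => ?_
    rw [Finset.mem_product] at hp
    simp [hp.1, hp.2]
  rw [hfil] at h1 h2
  refine ⟨h1, fun heq a ha b hb hamin hbmax => ?_⟩
  have hmin : S.min' hS = a := by
    by_contra hne
    exact absurd (hamin _ (S.min'_mem hS) hne) (not_lt.2 (hle_u _ _ (S.min'_le a ha)))
  have hmax : S.max' hS = b := by
    by_contra hne
    exact absurd (hbmax _ (S.max'_mem hS) hne) (not_lt.2 (hle_u _ _ (S.le_max' b hb)))
  have := h2 heq
  rw [hmin, hmax] at this
  exact this.imp id And.left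

open Classical in
/-- The rising pairs and the rising pairs of the mirror image, counted together. -/
theorem card_risingPair_add_le {ι : Type*} (S : Finset ι) (x u : ι → ℝ) (hS : S.Nonempty)
    (hinj : ∀ i j, x i = x j → u i = u j → i = j)
    (hP : ∀ i ∈ S, ∀ j ∈ S, u i < u j → (x j - x i) ^ 2 ≤ u j - u i) :
    ((S ×ˢ S).filter fun p => RisingPair x u p.1 p.2).card +
      ((S ×ˢ S).filter fun p => RisingPair (-x) u p.1 p.2).card + 2 ≤ 2 * S.card ∧
    (Set.InjOn u S → 2 ≤ S.card → ((S ×ˢ S).filter fun p => RisingPair x u p.1 p.2).card +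
      ((S ×ˢ S).filter fun p => RisingPair (-x) u p.1 p.2).card + 3 ≤ 2 * S.card) := by
  obtain ⟨h1, h1'⟩ := card_risingPair_le S x u hS hinj hP
  obtain ⟨h2, h2'⟩ := card_risingPair_le S (-x) u hS (fun i j h => hinj i j (by simpa using h))
    (fun i hi j hj h => by
      have := hP i hi j hj h
      simp only [Pi.neg_apply]
      nlinarith)
  refine ⟨by omega, fun hu hS2 => ?_⟩
  by_contra hcon
  obtain ⟨a, ha, hamin⟩ := S.exists_min_image u hS
  obtain ⟨b, hb, hbmax⟩ := S.exists_max_image u hS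
  have hamin' : ∀ i ∈ S, i ≠ a → u a < u i := fun i hi hne =>
    lt_of_le_of_ne (hamin i hi) fun h => hne (hu hi ha h.symm)
  have hbmax' : ∀ i ∈ S, i ≠ b → u i < u b := fun i hi hne =>
    lt_of_le_of_ne (hbmax i hi) fun h => hne (hu hi hb h)
  have hab : a ≠ b := by
    rintro rfl
    obtain ⟨c, hc, hca⟩ := Finset.exists_mem_ne hS2 a
    exact lt_asymm (hamin' c hc hca) (hbmax' c hc hca)
  -- A total of `2 * S.card - 2` forces equality in both classes, so the lowest and highest points
  -- are joined by a monotone path in each, in opposite directions.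
  have h3 := (h1' (by omega) a ha b hb hamin' hbmax').resolve_left hab
  have h4 := (h2' (by omega) a ha b hb hamin' hbmax').resolve_left hab
  simp only [Pi.neg_apply] at h4
  linarith

/-! ### Lines crossing a fixed line -/

theorem coordLine_ne {a b c a' b' c' : ℝ} (hD : a * b' - a' * b ≠ 0) :
    coordLine a b c ≠ coordLine a' b' c' := by
  intro h
  obtain ⟨hp, -⟩ := (mem_coordLine_and_iff (c := c) (c' := c') hD _).2 rfl
  set p := coordMeet a b c a' b' c'
  have hq : (p + !₂[-b, a] : Plane) ∈ coordLine a b c := by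
    rw [mem_coordLine] at hp ⊢
    simp only [PiLp.add_apply, Matrix.cons_val_zero, Matrix.cons_val_one]
    linear_combination hp
  rw [h, mem_coordLine] at hp hq
  simp only [PiLp.add_apply, Matrix.cons_val_zero, Matrix.cons_val_one] at hq
  exact hD (by linear_combination hq - hp)

theorem normal_ne_zero {a b : ℝ} (h : a ^ 2 + b ^ 2 = 1) : a ≠ 0 ∨ b ≠ 0 := by
  by_contra! hcon
  simp [hcon.1, hcon.2] at h

theorem ofReal_mul_unitTriangleArea_le_iff {x y : ℝ} (hy : 0 ≤ y) :
    ENNReal.ofReal x * unitTriangleArea ≤ ENNReal.ofReal y * unitTriangleArea ↔ x ≤ y := by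
  rw [ENNReal.mul_le_mul_iff_left unitTriangleArea_ne_zero unitTriangleArea_ne_top,
    ENNReal.ofReal_le_ofReal_iff hy]

theorem ofReal_mul_unitTriangleArea_inj {x y : ℝ} (hx : 0 ≤ x) (hy : 0 ≤ y) :
    ENNReal.ofReal x * unitTriangleArea = ENNReal.ofReal y * unitTriangleArea ↔ x = y := by
  rw [le_antisymm_iff, ofReal_mul_unitTriangleArea_le_iff hy,
    ofReal_mul_unitTriangleArea_le_iff hx, le_antisymm_iff]

/-- The lines crossing the line `a x + b y = c` with unit normal vector, parametrized by the point
of intersection and the cotangent of the angle. -/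
def transversal (a b c : ℝ) (p : ℝ × ℝ) : AffineSubspace ℝ Plane :=
  coordLine (p.2 * a - b) (p.2 * b + a) (p.2 * c + p.1)

section

variable {a b c : ℝ}

theorem transversal_cross (h : a ^ 2 + b ^ 2 = 1) (s : ℝ) :
    a * (s * b + a) - (s * a - b) * b = 1 := by
  linear_combination h

theorem transversal_cross_transversal (h : a ^ 2 + b ^ 2 = 1) (s s' : ℝ) :
    (s * a - b) * (s' * b + a) - (s' * a - b) * (s * b + a) = s - s' := by
  linear_combination (s - s') * h

theorem transversal_normal_ne_zero (h : a ^ 2 + b ^ 2 = 1) (s : ℝ) :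
    s * a - b ≠ 0 ∨ s * b + a ≠ 0 := by
  by_contra! hcon
  have := transversal_cross h s
  rw [hcon.1, hcon.2] at this
  simp at this

theorem exists_eq_transversal (h : a ^ 2 + b ^ 2 = 1) {a' b' : ℝ} (c c' : ℝ)
    (hD : a * b' - a' * b ≠ 0) : ∃ p, coordLine a' b' c' = transversal a b c p := by
  refine ⟨(c' / (a * b' - a' * b) - (a' * a + b' * b) / (a * b' - a' * b) * c,
    (a' * a + b' * b) / (a * b' - a' * b)), ?_⟩
  rw [transversal, ← coordLine_smul (inv_ne_zero hD)]
  simp only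
  congr 1
  · rw [div_mul_eq_mul_div, div_sub' hD, inv_mul_eq_div]
    congr 1
    linear_combination (-a') * h
  · rw [div_mul_eq_mul_div, div_add' _ _ _ hD, inv_mul_eq_div]
    congr 1
    linear_combination (-b') * h
  · ring

theorem coordLine_ne_transversal (h : a ^ 2 + b ^ 2 = 1) (p : ℝ × ℝ) :
    coordLine a b c ≠ transversal a b c p :=
  coordLine_ne (by rw [transversal_cross h]; exact one_ne_zero)

theorem coordDet_transversal (h : a ^ 2 + b ^ 2 = 1) (p q : ℝ × ℝ) :
    coordDet a b c (p.2 * a - b) (p.2 * b + a) (p.2 * c + p.1)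
      (q.2 * a - b) (q.2 * b + a) (q.2 * c + q.1) = q.1 - p.1 := by
  rw [coordDet, transversal_cross_transversal h, transversal_cross h, transversal_cross h]
  ring

open Classical in
theorem formsTriangle_transversal_iff (h : a ^ 2 + b ^ 2 = 1) {p q : ℝ × ℝ}
    (hne : transversal a b c p ≠ transversal a b c q) :
    FormsTriangle {coordLine a b c, transversal a b c p, transversal a b c q} ↔
      p.2 ≠ q.2 ∧ p.1 ≠ q.1 := by
  unfold transversal at *
  rw [formsTriangle_coordLine_iff (normal_ne_zero h) (transversal_normal_ne_zero h _)
    (transversal_normal_ne_zero h _) (coordLine_ne_transversal h p)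
    (coordLine_ne_transversal h q) hne, coordDet_transversal h, transversal_cross h,
    transversal_cross h, transversal_cross_transversal h, sub_ne_zero, sub_ne_zero,
    ne_comm (a := q.1)]
  simp

-- The base has length `|p.1 - q.1|`, and the height `h` satisfies `h |p.2 - q.2| = |p.1 - q.1|` by
-- the meaning of the cotangent.
open Classical in
theorem triangleArea_transversal (h : a ^ 2 + b ^ 2 = 1) {p q : ℝ × ℝ} (hpq : p.2 ≠ q.2) :
    triangleArea {coordLine a b c, transversal a b c p, transversal a b c q} =
      ENNReal.ofReal ((p.1 - q.1) ^ 2 / |p.2 - q.2|) * unitTriangleArea := by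
  have h3 : (p.2 * a - b) * (q.2 * b + a) - (q.2 * a - b) * (p.2 * b + a) ≠ 0 := by
    rw [transversal_cross_transversal h]
    exact sub_ne_zero.2 hpq
  have h1 (s : ℝ) : a * (s * b + a) - (s * a - b) * b ≠ 0 := by
    rw [transversal_cross h]
    exact one_ne_zero
  unfold transversal
  rw [triangleArea_coordLine (h1 _) (h1 _) h3 (coordLine_ne (h1 _)) (coordLine_ne (h1 _))
    (coordLine_ne h3), coordDet_transversal h, transversal_cross h, transversal_cross h,
    transversal_cross_transversal h, abs_one, one_mul, one_mul, ← neg_sub p.1, neg_sq]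

end

/-! ### The upper bound -/

theorem formsTriangle_of_mem_triangles {L t : Finset (AffineSubspace ℝ Plane)}
    (ht : t ∈ triangles L) : FormsTriangle t := by
  classical
  exact (Finset.mem_filter.1 ht).2

theorem subset_of_mem_triangles {L t : Finset (AffineSubspace ℝ Plane)}
    (ht : t ∈ triangles L) : t ⊆ L := by
  classical
  exact Finset.mem_powerset.1 (Finset.mem_filter.1 ht).1

theorem exists_eq_insert_pair {α : Type*} [DecidableEq α] {t : Finset α} {a : α} (h3 : t.card = 3) (ha : a ∈ t) :
    ∃ b c, a ≠ b ∧ a ≠ c ∧ b ≠ c ∧ t = {a, b, c} := by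
  have h2 : (t.erase a).card = 2 := by rw [Finset.card_erase_of_mem ha, h3]
  obtain ⟨b, c, hbc, h⟩ := Finset.card_eq_two.1 h2
  have hb : b ∈ t.erase a := by simp [h]
  have hc : c ∈ t.erase a := by simp [h]
  refine ⟨b, c, (Finset.ne_of_mem_erase hb).symm, (Finset.ne_of_mem_erase hc).symm, hbc, ?_⟩
  rw [← h, Finset.insert_erase ha]

open Classical in
/-- A triangle with a side on the line `a x + b y = c` has its other sides on transversals. -/
theorem FormsTriangle.exists_transversal {t : Finset (AffineSubspace ℝ Plane)} {a b c : ℝ}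
    (ht : FormsTriangle t) (hlines : ∀ l ∈ t, IsLine l) (h : a ^ 2 + b ^ 2 = 1)
    (hmem : coordLine a b c ∈ t) :
    ∃ p q : ℝ × ℝ, p.2 < q.2 ∧ p.1 ≠ q.1 ∧
      t = {coordLine a b c, transversal a b c p, transversal a b c q} := by
  obtain ⟨l, m, hl, hm, hlm, rfl⟩ := exists_eq_insert_pair ht.1 hmem
  have key : ∀ k, coordLine a b c ≠ k → k ∈ ({coordLine a b c, l, m} : Finset _) →
      ∃ p, k = transversal a b c p := by
    intro k hk hkt
    obtain ⟨a', b', c', h', rfl⟩ := (hlines k hkt).exists_eq_coordLine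
    refine exists_eq_transversal h c c' fun hD => hk ?_
    obtain ⟨r, hr, hr'⟩ := ht.2.1 _ hmem _ hkt hk
    exact coordLine_eq_of_mem (normal_ne_zero h) (normal_ne_zero h') hD hr hr'
  obtain ⟨p, rfl⟩ := key l hl (by simp)
  obtain ⟨q, rfl⟩ := key m hm (by simp)
  obtain ⟨h2, h1⟩ := (formsTriangle_transversal_iff h hlm).1 ht
  rcases lt_or_gt_of_ne h2 with h2 | h2
  · exact ⟨p, q, h2, h1, rfl⟩
  · exact ⟨q, p, h2, h1.symm, by rw [Finset.pair_comm]⟩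

theorem FormsTriangle.exists_area {t : Finset (AffineSubspace ℝ Plane)} (ht : FormsTriangle t)
    (hlines : ∀ l ∈ t, IsLine l) :
    ∃ A : ℝ, 0 < A ∧ triangleArea t = ENNReal.ofReal A * unitTriangleArea := by
  classical
  obtain ⟨l, hl⟩ : t.Nonempty := Finset.card_pos.1 (by rw [ht.1]; norm_num)
  obtain ⟨a, b, c, h, rfl⟩ := (hlines l hl).exists_eq_coordLine
  obtain ⟨p, q, h2, h1, rfl⟩ := ht.exists_transversal hlines h hl
  refine ⟨_, ?_, triangleArea_transversal h h2.ne⟩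
  have h3 : p.1 - q.1 ≠ 0 := sub_ne_zero.2 h1
  have h4 : p.2 - q.2 ≠ 0 := sub_ne_zero.2 h2.ne
  positivity

open Classical in
/-- The number of maximum-area triangles with a side on a given line, where no triangle has an area
above `A`. -/
theorem card_triangles_through_le {L : Finset (AffineSubspace ℝ Plane)} (hL : ∀ l ∈ L, IsLine l)
    {A : ℝ} (hA : 0 < A)
    (hmax : ∀ t ∈ triangles L, triangleArea t ≤ ENNReal.ofReal A * unitTriangleArea)
    (hL3 : 3 ≤ L.card) {l : AffineSubspace ℝ Plane} (hl : l ∈ L) :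
    (((triangles L).filter fun t => triangleArea t = ENNReal.ofReal A * unitTriangleArea).filter
      fun t => l ∈ t).card + 4 ≤ 2 * L.card ∧
    ((∃ m ∈ L, m ≠ l ∧ ¬ ∃ p, p ∈ l ∧ p ∈ m) ∨
        (∀ k ∈ L, ∀ m ∈ L, k ≠ m → ∃ p, p ∈ k ∧ p ∈ m) →
      (((triangles L).filter fun t => triangleArea t = ENNReal.ofReal A * unitTriangleArea).filter
        fun t => l ∈ t).card + 4 < 2 * L.card) := by
  set D := ((triangles L).filter fun t =>
    triangleArea t = ENNReal.ofReal A * unitTriangleArea).filter fun t => l ∈ t with hD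
  obtain ⟨a, b, c, h, rfl⟩ := (hL l hl).exists_eq_coordLine
  set T := L.filter fun m => ∃ p, m = transversal a b c p with hT
  have hTex : ∀ m : AffineSubspace ℝ Plane, ∃ p, m ∈ T → m = transversal a b c p := by
    intro m
    by_cases hm : m ∈ T
    · obtain ⟨p, hp⟩ := (Finset.mem_filter.1 hm).2
      exact ⟨p, fun _ => hp⟩
    · exact ⟨0, fun h => absurd h hm⟩
  choose f hf using hTex
  have hinjT : Set.InjOn f T := by
    intro m hm m' hm' hmm
    rw [hf m hm, hf m' hm', hmm]
  set P := T.image f with hP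
  have hPcard : P.card = T.card := Finset.card_image_of_injOn hinjT
  have hPmem : ∀ p, p ∈ P → transversal a b c p ∈ L := by
    intro p hp
    obtain ⟨m, hm, rfl⟩ := Finset.mem_image.1 hp
    rw [← hf m hm]
    exact (Finset.mem_filter.1 hm).1
  have hPinj : ∀ p ∈ P, ∀ q ∈ P, transversal a b c p = transversal a b c q → p = q := by
    intro p hp q hq hpq
    obtain ⟨m, hm, rfl⟩ := Finset.mem_image.1 hp
    obtain ⟨m', hm', rfl⟩ := Finset.mem_image.1 hq
    rw [← hf m hm, ← hf m' hm'] at hpq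
    rw [hpq]
  have hmeet : ∀ p, ∃ r, r ∈ coordLine a b c ∧ r ∈ transversal a b c p := fun p =>
    ⟨_, (mem_coordLine_and_iff (by rw [transversal_cross h]; exact one_ne_zero) _).2 rfl⟩
  have hTsub : T ⊆ L.erase (coordLine a b c) := by
    intro m hm
    obtain ⟨hmL, p, rfl⟩ := Finset.mem_filter.1 hm
    exact Finset.mem_erase.2 ⟨(coordLine_ne_transversal h p).symm, hmL⟩
  have hTcard : T.card + 1 ≤ L.card := by
    rw [← Finset.card_erase_add_one hl]
    exact Nat.add_le_add_right (Finset.card_le_card hTsub) 1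
  -- With the factor `A` in `u`, maximum area reads `(x - x')² = |u - u'|`.
  set x : ℝ × ℝ → ℝ := Prod.fst with hx
  set u : ℝ × ℝ → ℝ := fun p => A * p.2 with hu
  have hDle : D.card ≤ ((P ×ˢ P).filter fun p => RisingPair x u p.1 p.2).card +
      ((P ×ˢ P).filter fun p => RisingPair (-x) u p.1 p.2).card := by
    refine le_trans (Finset.card_le_card (t := (((P ×ˢ P).filter fun p => RisingPair x u p.1 p.2) ∪
      ((P ×ˢ P).filter fun p => RisingPair (-x) u p.1 p.2)).image fun p =>
        {coordLine a b c, transversal a b c p.1, transversal a b c p.2}) ?_)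
      (Finset.card_image_le.trans (Finset.card_union_le _ _))
    intro t ht
    rw [hD, Finset.mem_filter, Finset.mem_filter] at ht
    obtain ⟨⟨ht, hta⟩, htl⟩ := ht
    have htL := subset_of_mem_triangles ht
    obtain ⟨p', q', h2, h1, rfl⟩ := (formsTriangle_of_mem_triangles ht).exists_transversal
      (fun m hm => hL m (htL hm)) h htl
    have hrep : ∀ p', transversal a b c p' ∈ L → ∃ p ∈ P,
        transversal a b c p' = transversal a b c p := by
      intro p' hp'
      have : transversal a b c p' ∈ T := Finset.mem_filter.2 ⟨hp', p', rfl⟩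
      exact ⟨_, Finset.mem_image_of_mem f this, hf _ this⟩
    obtain ⟨p, hp, hpp⟩ := hrep p' (htL (by simp))
    obtain ⟨q, hq, hqq⟩ := hrep q' (htL (by simp))
    rw [hpp, hqq] at ht hta ⊢
    have hft := formsTriangle_of_mem_triangles ht
    have hne : transversal a b c p ≠ transversal a b c q := by
      intro heq
      have := hft.1
      rw [heq, Finset.pair_eq_singleton] at this
      have h' := Finset.card_le_two (a := coordLine a b c) (b := transversal a b c q)
      omega
    obtain ⟨k2, k1⟩ := (formsTriangle_transversal_iff h hne).1 hft
    rw [triangleArea_transversal h k2, ofReal_mul_unitTriangleArea_inj (by positivity) hA.le,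
      div_eq_iff (abs_ne_zero.2 (sub_ne_zero.2 k2))] at hta
    have key : ∀ p ∈ P, ∀ q ∈ P, p.2 < q.2 → p.1 ≠ q.1 →
        (p.1 - q.1) ^ 2 = A * |p.2 - q.2| →
        (p, q) ∈ ((P ×ˢ P).filter fun p => RisingPair x u p.1 p.2) ∪
          ((P ×ˢ P).filter fun p => RisingPair (-x) u p.1 p.2) := by
      intro p hp q hq h2 h1 harea
      rw [abs_of_neg (sub_neg.2 h2)] at harea
      have hAu : A * p.2 < A * q.2 := mul_lt_mul_of_pos_left h2 hA
      simp only [Finset.mem_union, Finset.mem_filter, Finset.mem_product, RisingPair, hx, hu,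
        Pi.neg_apply]
      rcases lt_or_gt_of_ne h1 with h1 | h1
      · exact .inl ⟨⟨hp, hq⟩, h1, hAu, by linear_combination harea⟩
      · exact .inr ⟨⟨hp, hq⟩, neg_lt_neg h1, hAu, by linear_combination harea⟩
    rcases lt_or_gt_of_ne k2 with k2 | k2
    · exact Finset.mem_image.2 ⟨(p, q), key p hp q hq k2 k1 hta, rfl⟩
    · refine Finset.mem_image.2 ⟨(q, p), key q hq p hp k2 k1.symm ?_, by rw [Finset.pair_comm]⟩
      rw [abs_sub_comm, ← hta]
      ring
  by_cases hPne : P.Nonempty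
  swap
  · rw [Finset.not_nonempty_iff_eq_empty] at hPne
    have hD0 : D.card = 0 := by
      rw [hPne] at hDle
      simpa using hDle
    rw [hD0]
    omega
  obtain ⟨hc1, hc2⟩ := card_risingPair_add_le P x u hPne
    (by
      intro p q h1 h2
      exact Prod.ext h1 (mul_left_cancel₀ hA.ne' h2))
    (by
      intro p hp q hq hpq
      have h2 : p.2 < q.2 := lt_of_mul_lt_mul_left hpq hA.le
      -- Transversals through the same point of the fixed line form no triangle with it, but the
      -- inequality is then trivial.
      by_cases h1 : p.1 = q.1
      · simp only [hx, hu, h1] at hpq ⊢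
        nlinarith
      have hne : transversal a b c p ≠ transversal a b c q :=
        fun heq => h1 (congrArg Prod.fst (hPinj p hp q hq heq))
      have hft := (formsTriangle_transversal_iff h hne).2 ⟨h2.ne, h1⟩
      have hmem : {coordLine a b c, transversal a b c p, transversal a b c q} ∈ triangles L := by
        refine Finset.mem_filter.2 ⟨Finset.mem_powerset.2 ?_, hft⟩
        intro m hm
        simp only [Finset.mem_insert, Finset.mem_singleton] at hm
        rcases hm with rfl | rfl | rfl
        · exact hl
        · exact hPmem _ hp
        · exact hPmem _ hq
      have := hmax _ hmem
      rw [triangleArea_transversal h h2.ne, ofReal_mul_unitTriangleArea_le_iff hA.le,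
        div_le_iff₀ (abs_pos.2 (sub_ne_zero.2 h2.ne)), abs_of_neg (sub_neg.2 h2)] at this
      simp only [hx, hu]
      linarith)
  refine ⟨by omega, ?_⟩
  rintro (⟨m, hm, hml, hpar⟩ | hall)
  -- A parallel line is not a transversal, so one point fewer is available.
  · have : T.card + 2 ≤ L.card := by
      have hsub : T ⊆ (L.erase (coordLine a b c)).erase m := by
        intro k hk
        refine Finset.mem_erase.2 ⟨?_, hTsub hk⟩
        rintro rfl
        apply hpar
        rw [hf k hk]
        exact hmeet _
      have h1 := Finset.card_le_card hsub
      have h2 := Finset.card_erase_add_one (Finset.mem_erase.2 ⟨hml, hm⟩)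
      have h3 := Finset.card_erase_add_one hl
      omega
    omega
  -- Without parallel lines the cotangents are distinct, so the sharper count applies.
  · have huinj : Set.InjOn u P := by
      intro p hp q hq hpq
      by_contra hne
      have h2 : p.2 = q.2 := mul_left_cancel₀ hA.ne' hpq
      have hne' : transversal a b c p ≠ transversal a b c q := fun heq => hne (hPinj p hp q hq heq)
      obtain ⟨r, hr, hr'⟩ := hall _ (hPmem p hp) _ (hPmem q hq) hne'
      exact hne' (coordLine_eq_of_mem (transversal_normal_ne_zero h _)
        (transversal_normal_ne_zero h _)
        (by rw [transversal_cross_transversal h, h2, sub_self]) hr hr')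
    have := hc2 huinj
    omega

-- Double counting of pairs of a maximal triangle and one of its sides: each line lies in at most `2
-- n - 4` of them, some line in fewer, and each triangle has three sides.
open Classical in
theorem card_maxAreaTriangles_lt {n : ℕ} (hn : 3 ≤ n) {L : Finset (AffineSubspace ℝ Plane)}
    (hL : IsArrangement n L) : ((maxAreaTriangles L).card : ℝ) < 2 / 3 * n * (n - 2) := by
  have hn' : (3 : ℝ) ≤ n := by exact_mod_cast hn
  rcases (maxAreaTriangles L).eq_empty_or_nonempty with h0 | ⟨t₀, ht₀⟩
  · rw [h0]
    simp only [Finset.card_empty, Nat.cast_zero]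
    have : (0 : ℝ) < n - 2 := by linarith
    positivity
  obtain ⟨hcard, hlines⟩ := hL
  obtain ⟨ht₀, ht₀max⟩ := Finset.mem_filter.1 ht₀
  obtain ⟨A, hA, hAeq⟩ := (formsTriangle_of_mem_triangles ht₀).exists_area
    (fun l hl => hlines l (subset_of_mem_triangles ht₀ hl))
  have hmax : ∀ t ∈ triangles L, triangleArea t ≤ ENNReal.ofReal A * unitTriangleArea :=
    fun t ht => hAeq ▸ ht₀max t ht
  have hM : maxAreaTriangles L = (triangles L).filter fun t =>
      triangleArea t = ENNReal.ofReal A * unitTriangleArea := by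
    refine Finset.filter_congr fun t ht => ⟨fun h => ?_, fun h => ?_⟩
    · exact le_antisymm (hmax t ht) (hAeq ▸ h t₀ ht₀)
    · rw [h]
      exact hmax
  have hdeg := fun l (hl : l ∈ L) =>
    card_triangles_through_le hlines hA hmax (by omega : 3 ≤ L.card) hl
  rw [← hM] at hdeg
  have hsum : ∑ l ∈ L, ((maxAreaTriangles L).filter fun t => l ∈ t).card =
      (maxAreaTriangles L).card * 3 := by
    have hcomm := Finset.sum_card_bipartiteAbove_eq_sum_card_bipartiteBelow
      (s := L) (t := maxAreaTriangles L) (fun l t => l ∈ t)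
    simp only [Finset.bipartiteAbove, Finset.bipartiteBelow] at hcomm
    rw [hcomm]
    refine Finset.sum_const_nat fun t ht => ?_
    have ht' := (Finset.mem_filter.1 ht).1
    have : L.filter (fun l => l ∈ t) = t := by
      rw [Finset.filter_mem_eq_inter, Finset.inter_eq_right.2 (subset_of_mem_triangles ht')]
    rw [this, (formsTriangle_of_mem_triangles ht').1]
  have hstrict : ∃ l ∈ L, ((maxAreaTriangles L).filter fun t => l ∈ t).card + 4 < 2 * L.card := by
    by_cases hpar : ∃ k ∈ L, ∃ m ∈ L, m ≠ k ∧ ¬ ∃ p, p ∈ k ∧ p ∈ m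
    · obtain ⟨k, hk, hkm⟩ := hpar
      exact ⟨k, hk, (hdeg k hk).2 (.inl hkm)⟩
    · push Not at hpar
      obtain ⟨l, hl⟩ : L.Nonempty := Finset.card_pos.1 (by omega)
      exact ⟨l, hl, (hdeg l hl).2 (.inr fun k hk m hm hkm => hpar k hk m hm hkm.symm)⟩
  have hlt := Finset.sum_lt_sum (fun l hl => (hdeg l hl).1) hstrict
  rw [Finset.sum_add_distrib, hsum, Finset.sum_const, Finset.sum_const, smul_eq_mul, smul_eq_mul,
    hcard] at hlt
  have hlt' : ((maxAreaTriangles L).card : ℝ) * 3 + n * 4 < n * (2 * n) := by exact_mod_cast hlt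
  linarith

/-! ### Recognizing maximum triangles in a sequence of lines -/

theorem exists_lt_lt_of_card_eq_three {α : Type*} [LinearOrder α] {s : Finset α}
    (hs : s.card = 3) : ∃ i j k, i < j ∧ j < k ∧ s = {i, j, k} := by
  have hne : s.Nonempty := Finset.card_pos.1 (by omega)
  obtain ⟨j, k, hj, hk, hjk, h⟩ := exists_eq_insert_pair hs (s.min'_mem hne)
  have hj' : s.min' hne < j := lt_of_le_of_ne (s.min'_le j (by rw [h]; simp)) hj
  have hk' : s.min' hne < k := lt_of_le_of_ne (s.min'_le k (by rw [h]; simp)) hk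
  rcases lt_or_gt_of_ne hjk with hlt | hlt
  · exact ⟨_, j, k, hj', hlt, h⟩
  · exact ⟨_, k, j, hk', hlt, by rwa [Finset.pair_comm]⟩

section

variable {a b c : ℕ → ℝ}

open Classical in
/-- If all normalized squared determinants of a sequence of lines are at most one, then the
triangles with normalized squared determinant one are those of maximum area. -/
theorem mem_maxAreaTriangles_of_coordDet_sq_eq
    (hD : ∀ i j, i < j → a i * b j - a j * b i ≠ 0)
    (hle : ∀ i j k, i < j → j < k →
      coordDet (a i) (b i) (c i) (a j) (b j) (c j) (a k) (b k) (c k) ^ 2 ≤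
        |a i * b j - a j * b i| * |a i * b k - a k * b i| * |a j * b k - a k * b j|)
    {n i j k : ℕ} (hij : i < j) (hjk : j < k) (hk : k < n)
    (heq : coordDet (a i) (b i) (c i) (a j) (b j) (c j) (a k) (b k) (c k) ^ 2 =
        |a i * b j - a j * b i| * |a i * b k - a k * b i| * |a j * b k - a k * b j|) :
    ({i, j, k} : Finset ℕ).image (fun i => coordLine (a i) (b i) (c i)) ∈
      maxAreaTriangles ((Finset.range n).image fun i => coordLine (a i) (b i) (c i)) := by
  have hne : ∀ i j, i < j → coordLine (a i) (b i) (c i) ≠ coordLine (a j) (b j) (c j) :=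
    fun i j h => coordLine_ne (hD i j h)
  have hnz : ∀ i, a i ≠ 0 ∨ b i ≠ 0 := by
    intro i
    by_contra! hcon
    apply hD i (i + 1) (Nat.lt_succ_self i)
    rw [hcon.1, hcon.2]
    ring
  have himage : ∀ i j k : ℕ, ({i, j, k} : Finset ℕ).image (fun i => coordLine (a i) (b i) (c i)) =
      {coordLine (a i) (b i) (c i), coordLine (a j) (b j) (c j), coordLine (a k) (b k) (c k)} := by
    intro i j k
    simp [Finset.image_insert]
  have harea : ∀ i j k, i < j → j < k →
      triangleArea (({i, j, k} : Finset ℕ).image (fun i => coordLine (a i) (b i) (c i))) =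
      ENNReal.ofReal (coordDet (a i) (b i) (c i) (a j) (b j) (c j) (a k) (b k) (c k) ^ 2 /
        (|a i * b j - a j * b i| * |a i * b k - a k * b i| * |a j * b k - a k * b j|)) *
        unitTriangleArea := by
    intro i j k hij hjk
    rw [himage]
    exact triangleArea_coordLine (hD _ _ hij) (hD _ _ (hij.trans hjk)) (hD _ _ hjk) (hne _ _ hij)
      (hne _ _ (hij.trans hjk)) (hne _ _ hjk)
  have hpos : ∀ i j k, i < j → j < k →
      0 < |a i * b j - a j * b i| * |a i * b k - a k * b i| * |a j * b k - a k * b j| := by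
    intro i j k hij hjk
    have h1 := hD _ _ hij
    have h2 := hD _ _ hjk
    have h3 := hD _ _ (hij.trans hjk)
    positivity
  have hmax : ∀ t ∈ triangles ((Finset.range n).image fun i => coordLine (a i) (b i) (c i)),
      triangleArea t ≤ ENNReal.ofReal 1 * unitTriangleArea := by
    intro t ht
    obtain ⟨s, -, rfl⟩ := Finset.subset_image_iff.1 (subset_of_mem_triangles ht)
    have hinj : Set.InjOn (fun i => coordLine (a i) (b i) (c i)) s := by
      intro i _ j _ h
      by_contra hcon
      rcases lt_or_gt_of_ne hcon with h' | h'
      · exact hne _ _ h' h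
      · exact hne _ _ h' h.symm
    have hs := (formsTriangle_of_mem_triangles ht).1
    rw [Finset.card_image_of_injOn hinj] at hs
    obtain ⟨i, j, k, hij, hjk, rfl⟩ := exists_lt_lt_of_card_eq_three hs
    rw [harea i j k hij hjk, ofReal_mul_unitTriangleArea_le_iff zero_le_one,
      div_le_one (hpos i j k hij hjk)]
    exact hle i j k hij hjk
  refine Finset.mem_filter.2 ⟨Finset.mem_filter.2 ⟨Finset.mem_powerset.2 ?_, ?_⟩, ?_⟩
  · refine Finset.image_subset_image fun x hx => ?_
    simp only [Finset.mem_insert, Finset.mem_singleton] at hx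
    rw [Finset.mem_range]
    omega
  · rw [himage, formsTriangle_coordLine_iff (hnz _) (hnz _) (hnz _) (hne _ _ hij)
      (hne _ _ (hij.trans hjk)) (hne _ _ hjk)]
    refine ⟨hD _ _ hij, hD _ _ (hij.trans hjk), hD _ _ hjk, fun h0 => ?_⟩
    have := hpos i j k hij hjk
    rw [← heq, h0] at this
    simp at this
  · intro t ht
    refine (hmax t ht).trans_eq ?_
    rw [harea i j k hij hjk, heq, div_self (hpos i j k hij hjk).ne']

end

/-! ### Pentagons at widely separated scales -/

/-- If the lines `x + u₁ y = w₁` and `x + u₂ y = w₂` form a triangle of area at most one with the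
`x`-axis, then also with a line `x + U y = W` far away. -/
theorem coordDet_sq_le_of_far {s R u₁ u₂ w₁ w₂ U W : ℝ} (hs : 0 < s) (hR : 1000 * s ≤ R)
    (hw₁ : 0 ≤ w₁) (hw₁' : w₁ ≤ 1.62 * s) (hw₂ : 0 ≤ w₂) (hw₂' : w₂ ≤ 1.62 * s) (hu₁ : 0 ≤ u₁)
    (hu₂ : u₂ ≤ 2.62 * s ^ 2) (he : 0.6 * s ^ 2 ≤ u₂ - u₁) (hW : 0.6 * R ≤ W) (hW' : W ≤ 1.62 * R)
    (hU : R ^ 2 ≤ U)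
    (hd : (w₂ - w₁) ^ 2 ≤ (u₂ - u₁) / 4 ∨ 0.34 * s ≤ w₂ - w₁ ∧ (w₂ - w₁) ^ 2 ≤ u₂ - u₁) :
    (w₁ * (U - u₂) - w₂ * (U - u₁) + W * (u₂ - u₁)) ^ 2 ≤ (u₂ - u₁) * (U - u₁) * (U - u₂) := by
  obtain ⟨e, rfl⟩ : ∃ e, u₂ = u₁ + e := ⟨u₂ - u₁, by ring⟩
  obtain ⟨d, rfl⟩ : ∃ d, w₂ = w₁ + d := ⟨w₂ - w₁, by ring⟩
  simp only [add_sub_cancel_left] at he hd ⊢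
  have hs2 : 0 < s ^ 2 := by positivity
  have he0 : 0 < e := by nlinarith
  have hRpos : 0 < R := by linarith
  have hf1 : w₁ * (u₁ + e) ≤ 1.62 * s * (2.62 * s ^ 2) := by gcongr
  have hf2 : (w₁ + d) * u₁ ≤ 1.62 * s * (2.62 * s ^ 2) := by gcongr; linarith
  have hf1' : 0 ≤ w₁ * (u₁ + e) := by positivity
  have hf2' : 0 ≤ (w₁ + d) * u₁ := by positivity
  have hse : s * (0.6 * s ^ 2) ≤ s * e := by gcongr
  have hRe : 1000 * s * e ≤ R * e := by gcongr
  have hWe : 0.6 * R * e ≤ W * e := by gcongr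
  have hWe' : W * e ≤ 1.62 * R * e := by gcongr
  -- The determinant is `Y - U * d`, where `Y` is close to `W * e`; the right-hand side is `e * U ^
  -- 2` up to lower order.
  obtain ⟨Y, hY⟩ : ∃ Y, Y = W * e - (w₁ * (u₁ + e) - (w₁ + d) * u₁) := ⟨_, rfl⟩
  have hYlow : 0.58 * (R * e) ≤ Y := by nlinarith
  have hYup : Y ≤ 1.7 * (R * e) := by nlinarith
  have hY0 : 0 < Y := lt_of_lt_of_le (by positivity) hYlow
  have hLHS : w₁ * (U - (u₁ + e)) - (w₁ + d) * (U - u₁) + W * e = Y - U * d := by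
    rw [hY]; ring
  rw [hLHS]
  have hRs : 1000000 * s ^ 2 ≤ R ^ 2 := by nlinarith
  have hU0 : 0 < U := by nlinarith
  have he' : e ≤ 2.62 * s ^ 2 := by linarith
  have hY2 : Y ^ 2 ≤ 8 * (e * U * s ^ 2) := by
    calc Y ^ 2 ≤ (1.7 * (R * e)) ^ 2 := by gcongr
      _ = 2.89 * (e * R ^ 2 * e) := by ring
      _ ≤ 2.89 * (e * U * (2.62 * s ^ 2)) := by gcongr
      _ ≤ 8 * (e * U * s ^ 2) := by nlinarith [mul_pos (mul_pos he0 hU0) hs2]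
  have hRHS : e * U * (U - 5.24 * s ^ 2) ≤ e * (U - u₁) * (U - (u₁ + e)) := by
    have : e * (U - u₁) * (U - (u₁ + e)) = e * U * (U - (u₁ + (u₁ + e))) + e * (u₁ * (u₁ + e)) := by
      ring
    rw [this]
    have h1 : e * U * (U - 5.24 * s ^ 2) ≤ e * U * (U - (u₁ + (u₁ + e))) := by
      gcongr
      linarith
    have h2 : 0 ≤ e * (u₁ * (u₁ + e)) := by positivity
    linarith
  refine le_trans ?_ hRHS
  have hUs : e * U * (1000000 * s ^ 2) ≤ e * U * U := by
    gcongr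
    linarith
  -- Either `d ^ 2` is well below `e` and there is room to spare, or `d > 0` and the negative cross
  -- term `-2 * U * d * Y` absorbs all errors, even if `d ^ 2 = e`.
  rcases hd with hd | ⟨hd, hd'⟩
  · have h1 : U ^ 2 * d ^ 2 ≤ U ^ 2 * (e / 4) := by gcongr
    have h2 : 0 < e * U * s ^ 2 := by positivity
    have h3 : (Y - U * d) ^ 2 ≤ 2 * Y ^ 2 + 2 * (U ^ 2 * d ^ 2) := by
      linarith [sq_nonneg (Y + U * d)]
    linarith
  · have h1 : U ^ 2 * d ^ 2 ≤ U ^ 2 * e := by gcongr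
    have h2 : 0.34 * s * (0.58 * (1000 * s * e)) ≤ d * Y := by
      have : 0.58 * (1000 * s * e) ≤ Y := by linarith
      gcongr
      linarith
    have h3 : U * (0.34 * s * (0.58 * (1000 * s * e))) ≤ U * (d * Y) := by gcongr
    have h4 : 0 < e * U * s ^ 2 := by positivity
    have h5 : (Y - U * d) ^ 2 = Y ^ 2 - 2 * (U * (d * Y)) + U ^ 2 * d ^ 2 := by ring
    linarith

section

open Real

theorem goldenRatio_bounds : 1.618 < goldenRatio ∧ goldenRatio < 1.6181 := by
  have h := goldenRatio_sq
  have h1 := one_lt_goldenRatio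
  constructor <;> nlinarith

/-- The coefficient `u` of three of the lines `x + u y = w` that form a regular pentagon, up to an
affinity, together with the axes. -/
noncomputable def pentagonU : ℕ → ℝ
  | 0 => 1
  | 1 => goldenRatio
  | _ => goldenRatio + 1

/-- The constant term `w` of three of the lines `x + u y = w` that form a regular pentagon, up to
an affinity, together with the axes. -/
noncomputable def pentagonW : ℕ → ℝ
  | 0 => 1
  | 1 => goldenRatio - 1
  | _ => goldenRatio

/-- The coefficients `u` of a sequence of lines `x + u y = w` that starts with the `y`-axis and
continues with scaled copies of three lines. -/
noncomputable def chainU : ℕ → ℝ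
  | 0 => 0
  | k + 1 => pentagonU (k % 3) * (1000 ^ (k / 3)) ^ 2

/-- The constant terms `w` that belong to `chainU`. -/
noncomputable def chainW : ℕ → ℝ
  | 0 => 0
  | k + 1 => pentagonW (k % 3) * 1000 ^ (k / 3)

/-- With `φ` the golden ratio, the constants round `φ ^ 2 = φ + 1` to `2.62`, `φ ^ 3` (the largest
`u / w ^ 2`) to `4.24`, and `φ` to `1.62`. -/
theorem pentagon_bounds (j : ℕ) : 1 ≤ pentagonU j ∧ pentagonU j ≤ 2.62 ∧ 0.618 ≤ pentagonW j ∧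
    pentagonW j ≤ 1.62 ∧ pentagonW j ^ 2 ≤ pentagonU j ∧
    pentagonU j ≤ 4.24 * pentagonW j ^ 2 := by
  obtain ⟨h1, h2⟩ := goldenRatio_bounds
  have h := goldenRatio_sq
  unfold pentagonU pentagonW
  split <;> refine ⟨?_, ?_, ?_, ?_, ?_, ?_⟩ <;> nlinarith

theorem chain_succ_bounds (k : ℕ) : ((1000 : ℝ) ^ (k / 3)) ^ 2 ≤ chainU (k + 1) ∧
    chainU (k + 1) ≤ 2.62 * (1000 ^ (k / 3)) ^ 2 ∧ 0.618 * 1000 ^ (k / 3) ≤ chainW (k + 1) ∧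
    chainW (k + 1) ≤ 1.62 * 1000 ^ (k / 3) ∧ chainW (k + 1) ^ 2 ≤ chainU (k + 1) ∧
    chainU (k + 1) ≤ 4.24 * chainW (k + 1) ^ 2 := by
  obtain ⟨h1, h2, h3, h4, h5, h6⟩ := pentagon_bounds (k % 3)
  simp only [chainU, chainW, mul_pow, ← mul_assoc]
  have hs : (0 : ℝ) < 1000 ^ (k / 3) := by positivity
  refine ⟨le_mul_of_one_le_left (by positivity) h1, ?_, ?_, ?_, ?_, ?_⟩ <;> gcongr

theorem scale_le {k l : ℕ} (h : k / 3 < l / 3) :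
    1000 * (1000 : ℝ) ^ (k / 3) ≤ 1000 ^ (l / 3) := by
  rw [← pow_succ']
  exact pow_le_pow_right₀ (by norm_num) h

theorem chain_nonneg (i : ℕ) : 0 ≤ chainU i ∧ 0 ≤ chainW i ∧ chainU i ≤ 4.24 * chainW i ^ 2 := by
  cases i with
  | zero => simp [chainU, chainW]
  | succ i =>
    obtain ⟨h1, h2, h3, h4, h5, h6⟩ := chain_succ_bounds i
    exact ⟨le_trans (by positivity) h1, le_trans (by positivity) h3, h6⟩

/-- Everything before a block is small compared to the scale of the block. -/
theorem chainW_le_of_block_lt {i k : ℕ} (h : i = 0 ∨ (i - 1) / 3 < k / 3) :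
    chainW i ≤ 0.002 * 1000 ^ (k / 3) := by
  cases i with
  | zero => simp only [chainW]; positivity
  | succ i =>
    have h' := scale_le (k := i) (l := k) (by simpa using h)
    have := (chain_succ_bounds i).2.2.2.1
    have hs : (0 : ℝ) < 1000 ^ (k / 3) := by positivity
    generalize (1000 : ℝ) ^ (i / 3) = r at *
    linarith

/-- These are the hypotheses of `coordDet_sq_le_of_far` on the two nearer lines. -/
theorem chain_pair {i k : ℕ} (hik : i < k + 1) :
    chainW i ≤ 1.62 * 1000 ^ (k / 3) ∧
    0.6 * (1000 ^ (k / 3)) ^ 2 ≤ chainU (k + 1) - chainU i ∧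
    ((chainW (k + 1) - chainW i) ^ 2 ≤ (chainU (k + 1) - chainU i) / 4 ∨
      0.34 * 1000 ^ (k / 3) ≤ chainW (k + 1) - chainW i ∧
        (chainW (k + 1) - chainW i) ^ 2 ≤ chainU (k + 1) - chainU i) := by
  obtain ⟨g1, g2⟩ := goldenRatio_bounds
  have g := goldenRatio_sq
  by_cases hb : i = 0 ∨ (i - 1) / 3 < k / 3
  · have h0 := chainW_le_of_block_lt hb
    obtain ⟨h1, h2, h3, h4, h5, h6⟩ := chain_succ_bounds k
    obtain ⟨k1, k2, k3⟩ := chain_nonneg i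
    have hs : (0 : ℝ) < 1000 ^ (k / 3) := by positivity
    -- The term `2 * chainW i * chainW (k + 1)` in the expanded square outweighs `chainU i` and
    -- `chainW i ^ 2`, both small multiples of `1000 ^ (k / 3) * chainW i`.
    have h7 : chainW i ^ 2 ≤ 0.002 * 1000 ^ (k / 3) * chainW i := by nlinarith
    have h8 : chainW i * (0.618 * 1000 ^ (k / 3)) ≤ chainW i * chainW (k + 1) := by gcongr
    have h9 : chainW i ^ 2 ≤ (0.002 * 1000 ^ (k / 3)) ^ 2 := by gcongr
    have h10 : 0 ≤ chainW i * 1000 ^ (k / 3) := by positivity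
    refine ⟨by linarith, by nlinarith, .inr ⟨by linarith, by nlinarith⟩⟩
  · cases i with
    | zero => simp at hb
    | succ i =>
      simp only [Nat.add_sub_cancel, not_or, not_lt] at hb
      have hblock : i / 3 = k / 3 := by omega
      simp only [chainU, chainW, hblock]
      have hs : (0 : ℝ) < 1000 ^ (k / 3) := by positivity
      generalize (1000 : ℝ) ^ (k / 3) = s at hs
      have hs2 : 0 < s ^ 2 := by positivity
      have htypes : i % 3 = 0 ∧ k % 3 = 1 ∨ i % 3 = 0 ∧ k % 3 = 2 ∨ i % 3 = 1 ∧ k % 3 = 2 := by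
        omega
      rcases htypes with ⟨hi, hk⟩ | ⟨hi, hk⟩ | ⟨hi, hk⟩ <;> rw [hi, hk] <;>
        simp only [pentagonU, pentagonW]
      -- The only pair along which `w` decreases; here `5 - 3 * φ` is just below `(φ - 1) / 4`.
      · refine ⟨by nlinarith, by nlinarith, .inl ?_⟩
        have : ((goldenRatio - 1) * s - 1 * s) ^ 2 = (5 - 3 * goldenRatio) * s ^ 2 := by
          linear_combination s ^ 2 * g
        rw [this]
        nlinarith
      · refine ⟨by nlinarith, by nlinarith, .inr ⟨by nlinarith, ?_⟩⟩
        have : (goldenRatio * s - 1 * s) ^ 2 = (2 - goldenRatio) * s ^ 2 := by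
          linear_combination s ^ 2 * g
        rw [this]
        nlinarith
      · refine ⟨by nlinarith, by nlinarith, .inr ⟨by nlinarith, ?_⟩⟩
        nlinarith

theorem chainU_strictMono {i j : ℕ} (h : i < j) : chainU i < chainU j := by
  cases j with
  | zero => omega
  | succ j =>
    have := (chain_pair h).2.1
    have hs : (0 : ℝ) < 0.6 * (1000 ^ (j / 3)) ^ 2 := by positivity
    linarith

theorem chainW_sub_sq_le {i j : ℕ} (h : i < j) :
    (chainW j - chainW i) ^ 2 ≤ chainU j - chainU i := by
  have hlt := chainU_strictMono h
  cases j with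
  | zero => omega
  | succ j =>
    rcases (chain_pair h).2.2 with h' | h'
    · linarith
    · exact h'.2

/-- The line `x + v y = y₀`, with `y₀` the given `y`, is a slightly displaced `y`-axis. For the pair
`0, 1` the `y`-axis itself gives equality, and the displacement decreases the determinant to first
order in `y`, while `v` is of second order. The other two pairs have ample slack. -/
theorem pentagon_far {y v : ℝ} (hy : 0 ≤ y) (hy' : y ≤ 0.002) (hv : 0 ≤ v)
    (hv' : v ≤ 4.24 * y ^ 2) {j k : ℕ} (hjk : j < k) (hk : k < 3) :
    (y * (pentagonU k - pentagonU j) - pentagonW j * (pentagonU k - v) +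
      pentagonW k * (pentagonU j - v)) ^ 2 ≤
      (pentagonU j - v) * (pentagonU k - v) * (pentagonU k - pentagonU j) := by
  obtain ⟨g1, g2⟩ := goldenRatio_bounds
  have g := goldenRatio_sq
  have hvy : v ≤ 0.01 * y := by nlinarith
  have htypes : j = 0 ∧ k = 1 ∨ j = 0 ∧ k = 2 ∨ j = 1 ∧ k = 2 := by omega
  rcases htypes with ⟨rfl, rfl⟩ | ⟨rfl, rfl⟩ | ⟨rfl, rfl⟩ <;> simp only [pentagonU, pentagonW]
  · obtain ⟨z, hz⟩ : ∃ z, z = y * (goldenRatio - 1) + v * (2 - goldenRatio) := ⟨_, rfl⟩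
    have h1 : y * (goldenRatio - 1) - 1 * (goldenRatio - v) + (goldenRatio - 1) * (1 - v) =
        z - 1 := by rw [hz]; ring
    have h2 : (1 - v) * (goldenRatio - v) * (goldenRatio - 1) =
        1 - goldenRatio * v + (goldenRatio - 1) * v ^ 2 := by
      linear_combination (1 - v) * g
    rw [h1, h2]
    have hz1 : 0.6 * y ≤ z := by nlinarith
    have hz2 : z ≤ 0.01 := by nlinarith
    have hz3 : z ^ 2 ≤ z := by nlinarith
    nlinarith [mul_nonneg (by linarith : 0 ≤ goldenRatio - 1) (sq_nonneg v)]
  · have h1 : (1 : ℝ) ≤ (1 - v) * (goldenRatio + 1 - v) * (goldenRatio + 1 - 1) := by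
      have : (0.9 : ℝ) * 2.5 ≤ (1 - v) * (goldenRatio + 1 - v) := by
        gcongr
        all_goals linarith
      have : (0.9 : ℝ) * 2.5 * 1.6 ≤ (1 - v) * (goldenRatio + 1 - v) * (goldenRatio + 1 - 1) := by
        gcongr <;> linarith
      linarith
    refine le_trans ?_ h1
    rw [sq_le_one_iff_abs_le_one, abs_le]
    constructor <;> nlinarith
  · have h1 : (1.1 : ℝ) ^ 2 ≤
        (goldenRatio - v) * (goldenRatio + 1 - v) * (goldenRatio + 1 - goldenRatio) := by
      have : (1.6 : ℝ) * 2.5 ≤ (goldenRatio - v) * (goldenRatio + 1 - v) := by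
        gcongr
        all_goals linarith
      have : (1.6 : ℝ) * 2.5 * 1 ≤
          (goldenRatio - v) * (goldenRatio + 1 - v) * (goldenRatio + 1 - goldenRatio) := by
        gcongr <;> linarith
      linarith
    refine le_trans ?_ h1
    refine sq_le_sq' ?_ ?_ <;> nlinarith

/-- Only the blocks matter: the last line in a later block is `coordDet_sq_le_of_far`, the last two
together after an earlier line is `pentagon_far`, and three lines of one block give equality. -/
theorem chain_coordDet_sq_le {i j k : ℕ} (hij : i < j) (hjk : j < k) :
    (chainW i * (chainU k - chainU j) - chainW j * (chainU k - chainU i) +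
      chainW k * (chainU j - chainU i)) ^ 2 ≤
      (chainU j - chainU i) * (chainU k - chainU i) * (chainU k - chainU j) := by
  obtain ⟨k1, k2, k3⟩ := chain_nonneg i
  obtain ⟨j, rfl⟩ : ∃ j', j = j' + 1 := ⟨j - 1, by omega⟩
  obtain ⟨k, rfl⟩ : ∃ k', k = k' + 1 := ⟨k - 1, by omega⟩
  have hs : (0 : ℝ) < 1000 ^ (j / 3) := by positivity
  by_cases hblock : j / 3 < k / 3
  · obtain ⟨p1, p2, p3⟩ := chain_pair hij
    obtain ⟨a1, a2, a3, a4, a5, a6⟩ := chain_succ_bounds j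
    obtain ⟨b1, b2, b3, b4, b5, b6⟩ := chain_succ_bounds k
    have hR : (0 : ℝ) < 1000 ^ (k / 3) := by positivity
    exact coordDet_sq_le_of_far hs (scale_le hblock) k2 p1 (by linarith) a4 k1 a2 p2 (by linarith)
      b4 b1 p3
  have hblock' : k / 3 = j / 3 := by omega
  by_cases hb : i = 0 ∨ (i - 1) / 3 < j / 3
  · have h0 := chainW_le_of_block_lt hb
    have key := pentagon_far (y := chainW i / 1000 ^ (j / 3))
      (v := chainU i / (1000 ^ (j / 3)) ^ 2) (by positivity)
      (by rwa [div_le_iff₀ hs]) (by positivity)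
      (by rw [div_pow, ← mul_div_assoc]; gcongr) (j := j % 3) (k := k % 3) (by omega) (by omega)
    have hUj : chainU (j + 1) = pentagonU (j % 3) * (1000 ^ (j / 3)) ^ 2 := rfl
    have hWj : chainW (j + 1) = pentagonW (j % 3) * 1000 ^ (j / 3) := rfl
    have hUk : chainU (k + 1) = pentagonU (k % 3) * (1000 ^ (j / 3)) ^ 2 := by rw [← hblock']; rfl
    have hWk : chainW (k + 1) = pentagonW (k % 3) * 1000 ^ (j / 3) := by rw [← hblock']; rfl
    rw [hUj, hWj, hUk, hWk]
    clear hUj hWj hUk hWk h0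
    generalize (1000 : ℝ) ^ (j / 3) = s at *
    obtain ⟨y, hy⟩ : ∃ y, chainW i = y * s := ⟨chainW i / s, by field_simp⟩
    obtain ⟨v, hv⟩ : ∃ v, chainU i = v * s ^ 2 := ⟨chainU i / s ^ 2, by field_simp⟩
    rw [hy, hv, mul_div_cancel_right₀ _ hs.ne', mul_div_cancel_right₀ _ (by positivity)] at key
    rw [hy, hv]
    -- Under the scaling `w` has weight one and `u` weight two, so both sides have weight six.
    have h1 := mul_le_mul_of_nonneg_left key (by positivity : 0 ≤ s ^ 6)
    linarith
  · obtain ⟨i, rfl⟩ : ∃ i', i = i' + 1 := ⟨i - 1, by omega⟩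
    simp only [Nat.add_sub_cancel, not_or, not_lt] at hb
    have hblock'' : i / 3 = j / 3 := by omega
    have hi : i % 3 = 0 := by omega
    have hj : j % 3 = 1 := by omega
    have hk : k % 3 = 2 := by omega
    simp only [chainU, chainW, hblock', hblock'', hi, hj, hk, pentagonU, pentagonW]
    have g := goldenRatio_sq
    generalize (1000 : ℝ) ^ (j / 3) = s
    apply le_of_eq
    linear_combination (-s ^ 6) * g

end

/-! ### The chain with both axes, and the count -/

/-- The coefficients of `x` of the sequence consisting of the `x`-axis and the lines
`x + chainU k * y = chainW k`. -/
def chainA : ℕ → ℝ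
  | 0 => 0
  | _ + 1 => 1

/-- The coefficients of `y` that belong to `chainA`. -/
noncomputable def chainB : ℕ → ℝ
  | 0 => 1
  | k + 1 => chainU k

/-- The constant terms that belong to `chainA`. -/
noncomputable def chainC : ℕ → ℝ
  | 0 => 0
  | k + 1 => chainW k

theorem chain_cross {i j : ℕ} (h : i < j) : |chainA i * chainB j - chainA j * chainB i| =
    match i with
    | 0 => 1
    | i + 1 => chainB j - chainU i := by
  obtain ⟨j, rfl⟩ : ∃ j', j = j' + 1 := ⟨j - 1, by omega⟩
  cases i with
  | zero => simp [chainA, chainB]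
  | succ i =>
    simp only [chainA, chainB, one_mul]
    exact abs_of_pos (sub_pos.2 (chainU_strictMono (by omega)))

theorem chain_cross_ne_zero {i j : ℕ} (h : i < j) :
    chainA i * chainB j - chainA j * chainB i ≠ 0 := by
  rw [← abs_pos, chain_cross h]
  obtain ⟨j, rfl⟩ : ∃ j', j = j' + 1 := ⟨j - 1, by omega⟩
  cases i with
  | zero => exact one_pos
  | succ i => exact sub_pos.2 (chainU_strictMono (by omega))

theorem chain_normalized_le {i j k : ℕ} (hij : i < j) (hjk : j < k) :
    coordDet (chainA i) (chainB i) (chainC i) (chainA j) (chainB j) (chainC j)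
      (chainA k) (chainB k) (chainC k) ^ 2 ≤
      |chainA i * chainB j - chainA j * chainB i| * |chainA i * chainB k - chainA k * chainB i| *
        |chainA j * chainB k - chainA k * chainB j| := by
  rw [chain_cross hij, chain_cross hjk, chain_cross (hij.trans hjk)]
  obtain ⟨j, rfl⟩ : ∃ j', j = j' + 1 := ⟨j - 1, by omega⟩
  obtain ⟨k, rfl⟩ : ∃ k', k = k' + 1 := ⟨k - 1, by omega⟩
  cases i with
  | zero =>
    have := chainW_sub_sq_le (i := j) (j := k) (by omega)
    simp only [coordDet, chainA, chainB, chainC]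
    linarith
  | succ i =>
    have := chain_coordDet_sq_le (i := i) (j := j) (k := k) (by omega) (by omega)
    simp only [coordDet, chainA, chainB, chainC]
    linarith

/-- The five triples of lines of maximum area in the block `m` of the chain. -/
def chainTriple (m : ℕ) : Fin 5 → ℕ × ℕ × ℕ
  | 0 => (0, 1, 3 * m + 2)
  | 1 => (0, 1, 3 * m + 4)
  | 2 => (0, 3 * m + 3, 3 * m + 4)
  | 3 => (1, 3 * m + 2, 3 * m + 3)
  | 4 => (3 * m + 2, 3 * m + 3, 3 * m + 4)

theorem chainTriple_lt (m : ℕ) (c : Fin 5) : (chainTriple m c).1 < (chainTriple m c).2.1 ∧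
    (chainTriple m c).2.1 < (chainTriple m c).2.2 ∧ (chainTriple m c).2.2 < 3 * m + 5 := by
  fin_cases c <;> simp [chainTriple]

/-- The largest index, through its residue modulo three, determines the block, so no triangle is
counted for two blocks even though the axes are shared. -/
theorem chainTriple_injective {m m' : ℕ} {c c' : Fin 5} (h : chainTriple m c = chainTriple m' c') :
    (m, c) = (m', c') := by
  fin_cases c <;> fin_cases c' <;> simp [chainTriple] at h ⊢ <;> omega

theorem insert_pair_injective {i j k i' j' k' : ℕ} (hij : i < j) (hjk : j < k) (hij' : i' < j')
    (hjk' : j' < k') (h : ({i, j, k} : Finset ℕ) = {i', j', k'}) : (i, j, k) = (i', j', k') := by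
  have h1 : i ∈ ({i', j', k'} : Finset ℕ) := by rw [← h]; simp
  have h2 : j ∈ ({i', j', k'} : Finset ℕ) := by rw [← h]; simp
  have h3 : k ∈ ({i', j', k'} : Finset ℕ) := by rw [← h]; simp
  simp only [Finset.mem_insert, Finset.mem_singleton] at h1 h2 h3
  simp only [Prod.mk.injEq]
  omega

theorem chain_block (m : ℕ) : chainU (3 * m + 1) = (1000 ^ m) ^ 2 ∧ chainW (3 * m + 1) = 1000 ^ m ∧
    chainU (3 * m + 2) = Real.goldenRatio * (1000 ^ m) ^ 2 ∧
    chainW (3 * m + 2) = (Real.goldenRatio - 1) * 1000 ^ m ∧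
    chainU (3 * m + 3) = (Real.goldenRatio + 1) * (1000 ^ m) ^ 2 ∧
    chainW (3 * m + 3) = Real.goldenRatio * 1000 ^ m := by
  have h0 : 3 * m % 3 = 0 ∧ 3 * m / 3 = m := by omega
  have h1 : (3 * m + 1) % 3 = 1 ∧ (3 * m + 1) / 3 = m := by omega
  have h2 : (3 * m + 2) % 3 = 2 ∧ (3 * m + 2) / 3 = m := by omega
  simp only [chainU, chainW, h0, h1, h2, pentagonU, pentagonW, one_mul, and_self]

theorem chain_normalized_eq {m : ℕ} {c : Fin 5} {i j k : ℕ} (h : chainTriple m c = (i, j, k)) :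
    coordDet (chainA i) (chainB i) (chainC i) (chainA j) (chainB j) (chainC j)
      (chainA k) (chainB k) (chainC k) ^ 2 =
      |chainA i * chainB j - chainA j * chainB i| * |chainA i * chainB k - chainA k * chainB i| *
        |chainA j * chainB k - chainA k * chainB j| := by
  have hlt := chainTriple_lt m c
  rw [h] at hlt
  rw [chain_cross hlt.1, chain_cross hlt.2.1, chain_cross (hlt.1.trans hlt.2.1)]
  obtain ⟨u0, w0, u1, w1, u2, w2⟩ := chain_block m
  have z : chainU 0 = 0 := rfl
  have z' : chainW 0 = 0 := rfl
  have g := Real.goldenRatio_sq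
  fin_cases c <;> simp only [chainTriple, Prod.mk.injEq] at h <;>
    obtain ⟨rfl, rfl, rfl⟩ := h <;>
    simp only [coordDet, chainA, chainB, chainC, u0, w0, u1, w1, u2, w2, z, z'] <;>
    generalize (1000 : ℝ) ^ m = s <;> generalize Real.goldenRatio = φ at g
  · ring
  · linear_combination s ^ 2 * g
  · ring
  · linear_combination (-s ^ 6) * g
  · linear_combination (-s ^ 6) * g

theorem five_mul_le_maxAreaNumber {n K : ℕ} (hn : 3 * K + 2 ≤ n) : 5 * K ≤ maxAreaNumber n := by
  classical
  set F : ℕ → AffineSubspace ℝ Plane := fun i => coordLine (chainA i) (chainB i) (chainC i) with hF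
  have hne : ∀ i j, i < j → F i ≠ F j := fun i j h => coordLine_ne (chain_cross_ne_zero h)
  have hFinj : Function.Injective F := by
    intro i j h
    by_contra hcon
    rcases lt_or_gt_of_ne hcon with h' | h'
    · exact hne _ _ h' h
    · exact hne _ _ h' h.symm
  have harr : IsArrangement n ((Finset.range n).image F) := by
    refine ⟨by rw [Finset.card_image_of_injective _ hFinj, Finset.card_range], fun l hl => ?_⟩
    obtain ⟨i, -, rfl⟩ := Finset.mem_image.1 hl
    cases i with
    | zero => exact isLine_coordLine (.inr one_ne_zero)
    | succ i => exact isLine_coordLine (.inl one_ne_zero)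
  refine le_trans ?_ (le_csSup (maxAreaCounts_bddAbove n) ⟨_, harr, rfl⟩)
  let G : ℕ × Fin 5 → Finset (AffineSubspace ℝ Plane) := fun p =>
    ({(chainTriple p.1 p.2).1, (chainTriple p.1 p.2).2.1, (chainTriple p.1 p.2).2.2} :
      Finset ℕ).image F
  have hG : Function.Injective G := by
    rintro ⟨m, c⟩ ⟨m', c'⟩ h
    have h' := Finset.image_injective hFinj h
    obtain ⟨h1, h2, -⟩ := chainTriple_lt m c
    obtain ⟨h1', h2', -⟩ := chainTriple_lt m' c'
    exact chainTriple_injective (insert_pair_injective h1 h2 h1' h2' h')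
  have hcard : ((Finset.range K ×ˢ (Finset.univ : Finset (Fin 5))).image G).card = 5 * K := by
    rw [Finset.card_image_of_injective _ hG, Finset.card_product, Finset.card_range,
      Finset.card_univ, Fintype.card_fin, mul_comm]
  rw [← hcard]
  refine Finset.card_le_card fun t ht => ?_
  obtain ⟨⟨m, c⟩, hmc, rfl⟩ := Finset.mem_image.1 ht
  have hm : m < K := Finset.mem_range.1 (Finset.mem_product.1 hmc).1
  obtain ⟨h1, h2, h3⟩ := chainTriple_lt m c
  exact mem_maxAreaTriangles_of_coordDet_sq_eq (fun i j h => chain_cross_ne_zero h)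
    (fun i j k hij hjk => chain_normalized_le hij hjk) h1 h2
    (show (chainTriple m c).2.2 < n by omega) (chain_normalized_eq rfl)

theorem theorem3 :
    (∃ C : ℝ, ∀ n : ℕ, (7 / 5 : ℝ) * (n : ℝ) - C < (maxAreaNumber n : ℝ)) ∧
      ∀ n : ℕ, 3 ≤ n → (maxAreaNumber n : ℝ) < (2 / 3 : ℝ) * (n : ℝ) * ((n : ℝ) - 2) := by
  refine ⟨⟨7, fun n => ?_⟩, fun n hn => ?_⟩
  · have h : 5 * ((n - 2) / 3) ≤ maxAreaNumber n := by
      rcases le_or_gt 2 n with h2 | h2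
      · exact five_mul_le_maxAreaNumber (by omega)
      · rw [show (n - 2) / 3 = 0 by omega]
        exact Nat.zero_le _
    -- Rounding down leaves at least `5 (n - 4) / 3`, which exceeds `7 n / 5 - 7` for every `n ≥ 0`.
    have h' : 7 * n < 5 * maxAreaNumber n + 35 := by omega
    have h'' : (7 * n : ℝ) < 5 * maxAreaNumber n + 35 := by exact_mod_cast h'
    linarith
  · obtain ⟨L, hL, hcard⟩ := (isGreatest_maxAreaNumber n).1
    rw [← hcard]
    exact card_maxAreaTriangles_lt hn hL
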